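/- Let $\tau$ be in the upper half-plane, $z\in\mathbb C$, $q=e^{2\pi i\tau}$, $r=e^{2\pi i z}$ (with $q^a=e^{2\pi i a\tau}$, $r^a=e^{2\pi i a z}$ for real $a$), and let $\eta(\tau)=q^{1/24}\prod_{m\ge1}(1-q^m)$. Put $\theta\left[{a\atop b}\right](\tau,z)=\sum_{\ell\in\mathbb Z}q^{\frac12(\ell+a/2)^2}r^{\ell+a/2}e^{i\pi \ell b}$, $\vartheta_2=\theta\left[{1\atop 0}\right]$, $\vartheta_3=\theta\left[{0\atop 0}\right]$, $\vartheta_4=\theta\left[{0\atop 1}\right]$, and $f_i=\vartheta_i(\tau,z)/\vartheta_i(\tau,0)$. The umbral Jacobi form of lambency $7$ is $$\psi_{0,6}=\psi_{0,2}\psi_{0,4}-\psi_{0,3}^2,$$ where $\psi_{0,1}=4(f_2^2+f_3^2+f_4^2)$, $\psi_{0,2}=2(f_2^2f_3^2+f_3^2f_4^2+f_4^2f_2^2)$, $\psi_{0,3}=4f_2^2f_3^2f_4^2$, $\psi_{0,4}=\frac14(\psi_{0,1}\psi_{0,3}-\psi_{0,2}^2)$. For integers $k\ge1$ and $n$ let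 $$\theta_{k,n}(\tau,z)=\sum_{m\in\mathbb Z}q^{k(m+\frac n{2k})^2}r^{k(m+\frac n{2k})},\qquad \mathcal M_{k,n}=\theta_{k,n}+\theta_{k,-n},$$ and for integers $0\le\lambda\le k$ let $$\chi_{k,\lambda}=\frac{\theta_{k+2,\lambda+1}-\theta_{k+2,-\lambda-1}}{\theta_{2,1}-\theta_{2,-1}}$$ be the normalized $\widehat{sl(2)}$ character. For integers $k\ge1$, $\lambda\ge0$ and $n\equiv\lambda \pmod 2$ let $$\mathcal D^{(k)}_{n,\lambda}(\tau)=\sum_{m\equiv\pm n\ (\mathrm{mod}\ 2k)}(-1)^{\frac{\lambda+m}2}\,q^{\frac{k(k+2)}8\left(\frac mk+\frac{\lambda+1}{k+2}\right)^2},$$ meaning the sum over the integers $m\equiv n$ plus the sum over the integers $m\equiv-n \pmod{2k}$. Identities that involve characters are asserted at all $(\tau,z)$ at which $\theta_{2,1}-\theta_{2,-1}\neq0$. Then the following hold. 1. $\eta\,\psi_{0,6}=\mathcal M_{24,2}+\mathcal M_{24,22}-\mathcal M_{24,10}-\mathcal M_{24,14}$ for all $(\tau,z)$. 2. For all integers $k\ge1$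 and $n$, the series $\mathcal D^{(k)}_{n,\lambda}$ converge absolutely (indeed $\sum_{m\in\mathbb Z}q^{\frac{k(k+2)}8\left(\frac mk+\frac{\lambda+1}{k+2}\right)^2}$ does, for every integer $\lambda\ge0$) and $$\mathcal M_{k,n}(\tau,z)=\sum_{\substack{0\le\lambda\le k\\ \lambda\equiv n\ (\mathrm{mod}\ 2)}}\mathcal D^{(k)}_{n,\lambda}(\tau)\,\chi_{k,\lambda}(\tau,z).$$ 3. For even $\lambda\ge0$ put $$G_\lambda(\tau)=\frac{(-1)^{\lambda/2}}{\eta(\tau)}\left(\sum_{\substack{m\in\mathbb Z\\ m\equiv\pm10\ (\mathrm{mod}\ 24)}}-\sum_{\substack{m\in\mathbb Z\\ m\equiv\pm2\ (\mathrm{mod}\ 24)}}\right)q^{78\left(\frac m{24}+\frac{\lambda+1}{26}\right)^2}.$$ Then $G_\lambda=\big(\mathcal D^{(24)}_{2,\lambda}+\mathcal D^{(24)}_{22,\lambda}-\mathcal D^{(24)}_{10,\lambda}-\mathcal D^{(24)}_{14,\lambda}\big)/\eta$ for every even $\lambda\ge 0$, and $$\psi_{0,6}(\tau,z)=\sum_{\substack{0\le\lambda\le24\\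 \lambda\text{ even}}}G_\lambda(\tau)\,\chi_{24,\lambda}(\tau,z).$$ 4. Functions $g_1,\dots,g_7$ of $\tau$ satisfy $$\psi_{0,6}(\tau,z)=g_1(\tau)\chi_{24,12}(\tau,z)+\sum_{j=2}^7 g_j(\tau)\big[\chi_{24,14-2j}(\tau,z)+\chi_{24,10+2j}(\tau,z)\big]$$ if and only if $g_j=G_{14-2j}$ for $j=1,\dots,7$. -/

import Mathlib

open scoped UpperHalfPlane

noncomputable section

namespace Umbral

/-- `expPow w a = exp (2 π i a w)`; thus `q ^ a = expPow τ a` and `r ^ a = expPow z a`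
for `q = exp (2 π i τ)`, `r = exp (2 π i z)` and a real exponent `a`. -/
def expPow (w : ℂ) (a : ℝ) : ℂ :=
  Complex.exp (2 * Real.pi * Complex.I * (a : ℂ) * w)

/-- The Dedekind eta function `q ^ (1 / 24) ∏ (1 - q ^ m)` on the upper half-plane. -/
def eta (τ : ℍ) : ℂ := ModularForm.eta (τ : ℂ)

/-- The genus-one theta function with characteristics `a, b`:
`∑ l, q ^ ((l + a / 2) ^ 2 / 2) r ^ (l + a / 2) e ^ (i π l b)`. -/
def thetaChar (a b : ℤ) (τ : ℍ) (z : ℂ) : ℂ :=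
  ∑' l : ℤ, expPow τ (((l : ℝ) + (a : ℝ) / 2) ^ 2 / 2) * expPow z ((l : ℝ) + (a : ℝ) / 2) *
    Complex.exp (Complex.I * Real.pi * (l : ℂ) * (b : ℂ))

/-- `f₂ = ϑ₂(τ, z) / ϑ₂(τ, 0)`. -/
def f2 (τ : ℍ) (z : ℂ) : ℂ := thetaChar 1 0 τ z / thetaChar 1 0 τ 0

/-- `f₃ = ϑ₃(τ, z) / ϑ₃(τ, 0)`. -/
def f3 (τ : ℍ) (z : ℂ) : ℂ := thetaChar 0 0 τ z / thetaChar 0 0 τ 0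

/-- `f₄ = ϑ₄(τ, z) / ϑ₄(τ, 0)`. -/
def f4 (τ : ℍ) (z : ℂ) : ℂ := thetaChar 0 1 τ z / thetaChar 0 1 τ 0

/-- The umbral Jacobi form of lambency 2. -/
def psi1 (τ : ℍ) (z : ℂ) : ℂ := 4 * (f2 τ z ^ 2 + f3 τ z ^ 2 + f4 τ z ^ 2)

/-- The umbral Jacobi form of lambency 3. -/
def psi2 (τ : ℍ) (z : ℂ) : ℂ :=
  2 * (f2 τ z ^ 2 * f3 τ z ^ 2 + f3 τ z ^ 2 * f4 τ z ^ 2 + f4 τ z ^ 2 * f2 τ z ^ 2)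

/-- The umbral Jacobi form of lambency 4. -/
def psi3 (τ : ℍ) (z : ℂ) : ℂ := 4 * f2 τ z ^ 2 * f3 τ z ^ 2 * f4 τ z ^ 2

/-- The umbral Jacobi form of lambency 5. -/
def psi4 (τ : ℍ) (z : ℂ) : ℂ := 1 / 4 * (psi1 τ z * psi3 τ z - psi2 τ z ^ 2)

/-- The umbral Jacobi form of lambency 7 (weight 0, index 6). -/
def psi6 (τ : ℍ) (z : ℂ) : ℂ := psi2 τ z * psi4 τ z - psi3 τ z ^ 2

/-- The classical theta function
`θ_{k,n} = ∑ m, q ^ (k (m + n / (2 k)) ^ 2) r ^ (k (m + n / (2 k)))` (for `k ≥ 1`). -/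
def theta (k : ℕ) (n : ℤ) (τ : ℍ) (z : ℂ) : ℂ :=
  ∑' m : ℤ, expPow τ ((k : ℝ) * ((m : ℝ) + (n : ℝ) / (2 * (k : ℝ))) ^ 2) *
    expPow z ((k : ℝ) * ((m : ℝ) + (n : ℝ) / (2 * (k : ℝ))))

/-- `M_{k,n} = θ_{k,n} + θ_{k,-n}`. -/
def thetaSym (k : ℕ) (n : ℤ) (τ : ℍ) (z : ℂ) : ℂ := theta k n τ z + theta k (-n) τ z

/-- The denominator `θ_{2,1} - θ_{2,-1}` of the affine `sl(2)` characters. -/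
def charDenom (τ : ℍ) (z : ℂ) : ℂ := theta 2 1 τ z - theta 2 (-1) τ z

/-- The normalized affine `sl(2)` character of level `k` and spin label `l` (for `l ≤ k`),
at points where the denominator does not vanish. -/
def chi (k l : ℕ) (τ : ℍ) (z : ℂ) : ℂ :=
  (theta (k + 2) ((l : ℤ) + 1) τ z - theta (k + 2) (-(l : ℤ) - 1) τ z) / charDenom τ z

/-- The power `q ^ (k (k + 2) / 8 * (m / k + (l + 1) / (k + 2)) ^ 2)`. -/
def heckeTerm (k l : ℕ) (τ : ℍ) (m : ℤ) : ℂ :=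
  expPow τ ((k : ℝ) * ((k : ℝ) + 2) / 8 *
    ((m : ℝ) / (k : ℝ) + ((l : ℝ) + 1) / ((k : ℝ) + 2)) ^ 2)

/-- The part of `D^{(k)}_{n,l}` that comes from one residue class:
`∑_{m ≡ n mod 2k} (-1) ^ ((l + m) / 2) q ^ (k (k + 2) / 8 * (m / k + (l + 1) / (k + 2)) ^ 2)`.
It is used only when `l + n` is even, and then every `l + m` is even. -/
def transHalf (k : ℕ) (n : ℤ) (l : ℕ) (τ : ℍ) : ℂ :=
  ∑' m : {m : ℤ // m ≡ n [ZMOD 2 * (k : ℤ)]},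
    (-1 : ℂ) ^ (((l : ℤ) + (m : ℤ)) / 2) * heckeTerm k l τ (m : ℤ)

/-- The coefficient `D^{(k)}_{n,l}`: the sum over `m ≡ ± n mod 2k`, the two classes `n` and `-n`
being counted separately (they are distinct unless `k` divides `n`). -/
def transCoeff (k : ℕ) (n : ℤ) (l : ℕ) (τ : ℍ) : ℂ :=
  transHalf k n l τ + transHalf k (-n) l τ

/-- `∑ q ^ (78 (m / 24 + (l + 1) / 26) ^ 2)` over the integers `m ≡ ± c mod 24`. -/
def classSum (c : ℤ) (l : ℕ) (τ : ℍ) : ℂ :=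
  ∑' m : {m : ℤ // m ≡ c [ZMOD 24] ∨ m ≡ -c [ZMOD 24]},
    expPow τ (78 * (((m : ℤ) : ℝ) / 24 + ((l : ℝ) + 1) / 26) ^ 2)

/-- The explicit coefficient of the character `χ_{24,l}` (for even `l`). -/
def explicitCoeff (l : ℕ) (τ : ℍ) : ℂ :=
  (-1 : ℂ) ^ (l / 2) * (classSum 10 l τ - classSum 2 l τ) / eta τ

/-- `g = (g₁, …, g₇)` (here indexed from `0`) are the coefficients of the decomposition of the
lambency-7 umbral Jacobi form into level 24 characters:
`ψ = g₁ χ_{24,12} + ∑_{j = 2}^{7} g_j (χ_{24,14-2j} + χ_{24,10+2j})`. -/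
def IsCharDecomposition (g : Fin 7 → ℍ → ℂ) : Prop :=
  ∀ (τ : ℍ) (z : ℂ), charDenom τ z ≠ 0 →
    psi6 τ z = g 0 τ * chi 24 12 τ z
      + g 1 τ * (chi 24 10 τ z + chi 24 14 τ z)
      + g 2 τ * (chi 24 8 τ z + chi 24 16 τ z)
      + g 3 τ * (chi 24 6 τ z + chi 24 18 τ z)
      + g 4 τ * (chi 24 4 τ z + chi 24 20 τ z)
      + g 5 τ * (chi 24 2 τ z + chi 24 22 τ z)
      + g 6 τ * (chi 24 0 τ z + chi 24 24 τ z)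

end Umbral

end

/-!
All functions of `z` that occur are weighted theta series `∑ w(N) q ^ (α N ^ 2) r ^ (N / 2)` with
a bounded weight `w` (`wsum`). Three facts about them carry the argument: they are entire in `z`
(`differentiable_wsum`), the weights are determined by the function (`wsum_eq_zero`, by integration
over a period), and a product of two of them is again such a series, with coefficients obtained by
completing the square (`wsum_mul_wsum`).

*Characters.* In the product of `M_{k,n}` with the denominator `θ_{2,1} - θ_{2,-1}`, the
coefficient of `q ^ (N ^ 2 / (4 (k + 2))) r ^ (N / 2)` is odd in `N` and has period `2 (k + 2)`,
so that the classes `0` and `k + 2` drop out and the others pair up to the numerators of the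
characters. At `N = l + 1` the coefficient is `D^{(k)}_{n,l}` or, by parity, zero
(`productCoeff_eq_transCoeff`, `productCoeff_eq_zero`).

*Theta expansion.* The addition formula for `ϑ_i(x) ϑ_i(y)` (`thetaChar_mul_thetaChar`) expresses
`f_i(z) ^ 2` and `f_i(2 z)` rationally through the values of `θ_{1,0}` and `θ_{1,1}` at `2 z` and
`0`. This gives the duplication formulas (`duplication`), from which
`ψ_{0,6}(z) = 2 f₂(2 z) f₃(2 z) f₄(2 z)` is a polynomial identity (`psi6_eq`). A Landen
transformation writes `ϑ₂ ϑ₃ ϑ₄` as a product of two theta series and a factor independent of `z`;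
the coefficients of that product are even and have antiperiod `6`, hence are proportional to the
character `(12 / N)`. The factor of proportionality is nonzero, because `ϑ₂ ϑ₃ ϑ₄` is not
identically zero, and it cancels in `f₂ f₃ f₄`: the value at `z = 0` is `2 η` times the same factor,
by Euler's pentagonal number theorem. The result is the quintuple product identity
(`two_eta_mul_f2_f3_f4`); at `2 z` its right-hand side is the combination of the `M_{24,n}`. The
same argument shows that the theta constants in the denominators of `f₂, f₃, f₄` do not vanish.

*Uniqueness.* For fixed `τ` the characters of a given level are linearly independent
(`chi_linearIndependent`), because their numerators have disjoint Fourier modes and the denominator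
is an entire function that is not identically zero. The coefficients found are symmetric under
`l ↦ 24 - l` (`explicitCoeff_reflect`), which is why they can be grouped into seven.
-/

noncomputable section

namespace Umbral


/-! ### Exponential terms -/

lemma expPow_add (w : ℂ) (a b : ℝ) : expPow w (a + b) = expPow w a * expPow w b := by
  rw [expPow, expPow, expPow, ← Complex.exp_add]
  congr 1
  push_cast
  ring

lemma expPow_zero_left (a : ℝ) : expPow 0 a = 1 := by simp [expPow]

lemma expPow_ne_zero (w : ℂ) (a : ℝ) : expPow w a ≠ 0 := Complex.exp_ne_zero _

lemma expPow_add_left (w w' : ℂ) (a : ℝ) : expPow (w + w') a = expPow w a * expPow w' a := by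
  rw [expPow, expPow, expPow, ← Complex.exp_add]
  congr 1
  ring

lemma expPow_neg_left (w : ℂ) (a : ℝ) : expPow (-w) a = expPow w (-a) := by
  rw [expPow, expPow]
  congr 1
  push_cast
  ring

lemma norm_expPow (w : ℂ) (a : ℝ) : ‖expPow w a‖ = Real.exp (-2 * Real.pi * a * w.im) := by
  rw [expPow, Complex.norm_exp]
  congr 1
  simp

lemma expPow_nat (w : ℂ) (n : ℕ) : expPow w n = expPow w 1 ^ n := by
  rw [expPow, expPow, ← Complex.exp_nat_mul]
  congr 1
  push_cast
  ring

/-- Absolute convergence of every theta-like series: the general term is a constant multiple of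
a term of Mathlib's two-variable theta function. -/
lemma summable_norm_expPow_mul {α : ℝ} (hα : 0 < α) (β γ δ ε : ℝ) (τ : ℍ) (z : ℂ) :
    Summable fun m : ℤ =>
      ‖expPow τ (α * (m : ℝ) ^ 2 + β * m + γ) * expPow z (δ * m + ε)‖ := by
  have h : 0 < (2 * (α : ℂ) * (τ : ℂ)).im := by
    have := τ.im_pos
    have h2 : (2 * (α : ℂ) * (τ : ℂ)).im = 2 * α * τ.im := by simp
    rw [h2]
    positivity
  have hs := ((summable_jacobiTheta₂_term_iff ((β : ℂ) * τ + δ * z) _).mpr h).norm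
  refine (hs.mul_left ‖expPow τ γ * expPow z ε‖).congr fun m => ?_
  rw [← norm_mul]
  congr 1
  simp only [jacobiTheta₂_term, expPow, ← Complex.exp_add]
  congr 1
  push_cast
  ring

/-- A sum over an arithmetic progression is a sum over all integers with an indicator weight. -/
lemma tsum_progression {p : ℤ} (hp : p ≠ 0) (c : ℤ) (g : ℤ → ℂ) :
    ∑' m : ℤ, g (p * m + c) = ∑' N : ℤ, (if N ≡ c [ZMOD p] then (1 : ℂ) else 0) * g N := by
  have hinj : Function.Injective fun m : ℤ => p * m + c := fun a b h =>
    mul_left_cancel₀ hp (add_right_cancel h)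
  rw [← hinj.tsum_eq (f := fun N => (if N ≡ c [ZMOD p] then (1 : ℂ) else 0) * g N)]
  · refine tsum_congr fun m => ?_
    rw [if_pos, one_mul]
    exact (Int.modEq_iff_dvd.mpr ⟨-m, by ring⟩)
  · intro N hN
    by_cases h : N ≡ c [ZMOD p]
    · obtain ⟨t, ht⟩ := Int.modEq_iff_dvd.mp h
      exact ⟨-t, by simp only; linarith⟩
    · simp [h] at hN

/-! ### Weighted theta series -/

/-- The theta series `∑ N, w N q ^ (α N ^ 2) r ^ (N / 2)`. It converges absolutely when the weight `w`
is bounded and `α > 0`; these are hypotheses of the lemmas, not part of the definition. -/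
def wsum (w : ℤ → ℂ) (α : ℝ) (τ : ℍ) (z : ℂ) : ℂ :=
  ∑' N : ℤ, w N * (expPow τ (α * (N : ℝ) ^ 2) * expPow z ((N : ℝ) / 2))

lemma summable_norm_wsum {w : ℤ → ℂ} {C : ℝ} (hw : ∀ N, ‖w N‖ ≤ C) {α : ℝ} (hα : 0 < α)
    (τ : ℍ) (z : ℂ) :
    Summable fun N : ℤ => ‖w N * (expPow τ (α * (N : ℝ) ^ 2) * expPow z ((N : ℝ) / 2))‖ := by
  refine Summable.of_nonneg_of_le (fun _ => norm_nonneg _) (fun N => ?_)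
    ((summable_norm_expPow_mul hα 0 0 (1 / 2) 0 τ z).mul_left C)
  rw [norm_mul]
  refine mul_le_mul (hw N) (le_of_eq ?_) (norm_nonneg _) ((norm_nonneg _).trans (hw N))
  ring_nf

lemma wsum_add {w v : ℤ → ℂ} {C D : ℝ} (hw : ∀ N, ‖w N‖ ≤ C) (hv : ∀ N, ‖v N‖ ≤ D) {α : ℝ}
    (hα : 0 < α) (τ : ℍ) (z : ℂ) :
    wsum (fun N => w N + v N) α τ z = wsum w α τ z + wsum v α τ z := by
  rw [wsum, wsum, wsum, ← Summable.tsum_add (summable_norm_wsum hw hα τ z).of_norm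
    (summable_norm_wsum hv hα τ z).of_norm]
  exact tsum_congr fun N => by ring

lemma wsum_const_mul (c : ℂ) (w : ℤ → ℂ) (α : ℝ) (τ : ℍ) (z : ℂ) :
    wsum (fun N => c * w N) α τ z = c * wsum w α τ z := by
  rw [wsum, wsum, ← tsum_mul_left]
  exact tsum_congr fun N => by ring

lemma wsum_sub {w v : ℤ → ℂ} {C D : ℝ} (hw : ∀ N, ‖w N‖ ≤ C) (hv : ∀ N, ‖v N‖ ≤ D) {α : ℝ}
    (hα : 0 < α) (τ : ℍ) (z : ℂ) :
    wsum (fun N => w N - v N) α τ z = wsum w α τ z - wsum v α τ z := by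
  rw [wsum, wsum, wsum, ← Summable.tsum_sub (summable_norm_wsum hw hα τ z).of_norm
    (summable_norm_wsum hv hα τ z).of_norm]
  exact tsum_congr fun N => by ring

/-- A weighted theta series is an entire function of `z`. -/
lemma differentiable_wsum {w : ℤ → ℂ} {C : ℝ} (hw : ∀ N, ‖w N‖ ≤ C) {α : ℝ} (hα : 0 < α)
    (τ : ℍ) : Differentiable ℂ (wsum w α τ) := by
  intro z₀
  set R : ℝ := |z₀.im| + 1
  have hopen : IsOpen {z : ℂ | |z.im| < R} :=
    isOpen_lt (Complex.continuous_im.abs) continuous_const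
  have hmem : z₀ ∈ {z : ℂ | |z.im| < R} := by simp [R]
  have hT : 0 < 2 * α * τ.im := by have := τ.im_pos; positivity
  have hsum := (summable_pow_mul_jacobiTheta₂_term_bound (R / 2) hT 0).mul_left C
  have := Complex.differentiableOn_tsum_of_summable_norm (U := {z : ℂ | |z.im| < R}) (F := fun N z =>
    w N * (expPow τ (α * (N : ℝ) ^ 2) * expPow z ((N : ℝ) / 2))) hsum ?_ hopen ?_
  · exact this.differentiableAt (hopen.mem_nhds hmem)
  · intro N
    simp only [expPow]
    fun_prop
  · intro N z hz
    rw [norm_mul]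
    refine mul_le_mul (hw N) ?_ (norm_nonneg _) ((norm_nonneg _).trans (hw N))
    rw [norm_mul, norm_expPow, norm_expPow, ← Real.exp_add, pow_zero, one_mul]
    refine Real.exp_le_exp.mpr ?_
    have h1 : -((N : ℝ) * z.im) ≤ R * |(N : ℝ)| := by
      calc -((N : ℝ) * z.im) ≤ |(N : ℝ) * z.im| := neg_le_abs _
        _ = |z.im| * |(N : ℝ)| := by rw [abs_mul, mul_comm]
        _ ≤ _ := mul_le_mul_of_nonneg_right (le_of_lt hz) (abs_nonneg _)
    have h2 := mul_le_mul_of_nonneg_left h1 Real.pi_pos.le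
    have h3 : ((τ : ℂ)).im = τ.im := rfl
    rw [h3]
    push_cast
    nlinarith [h2]

lemma integral_expPow_half (n : ℤ) :
    ∫ x in (0 : ℝ)..2, expPow (x : ℂ) ((n : ℝ) / 2) = if n = 0 then 2 else 0 := by
  split_ifs with h
  · subst h
    simp [expPow]
  · have hc : (Real.pi * Complex.I * n : ℂ) ≠ 0 := by
      simp [Real.pi_ne_zero, Complex.I_ne_zero, h]
    have h1 : ∀ x : ℝ, expPow (x : ℂ) ((n : ℝ) / 2)
        = Complex.exp ((Real.pi * Complex.I * n : ℂ) * x) := fun x => by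
      rw [expPow]
      congr 1
      push_cast
      ring
    simp_rw [h1]
    rw [integral_exp_mul_complex hc]
    have h2 : Complex.exp ((Real.pi * Complex.I * n : ℂ) * (2 : ℝ)) = 1 := by
      rw [← Complex.exp_int_mul_two_pi_mul_I n]
      congr 1
      push_cast
      ring
    rw [h2]
    simp

/-- Fourier uniqueness: the weights of a theta series are determined by its values. -/
lemma wsum_eq_zero {w : ℤ → ℂ} {C : ℝ} (hw : ∀ N, ‖w N‖ ≤ C) {α : ℝ} (hα : 0 < α)
    {τ : ℍ} (h : ∀ z, wsum w α τ z = 0) (n : ℤ) : w n = 0 := by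
  have hb := summable_norm_wsum hw hα τ 0
  -- Multiply the series by `r ^ (-n / 2)` and integrate over the period `0 ≤ z ≤ 2`.
  have key := intervalIntegral.hasSum_integral_of_dominated_convergence (μ := MeasureTheory.volume)
    (a := 0) (b := 2) (f := fun _ => (0 : ℂ))
    (F := fun (N : ℤ) (x : ℝ) => w N * (expPow τ (α * (N : ℝ) ^ 2)) *
      expPow (x : ℂ) (((N - n : ℤ) : ℝ) / 2))
    (fun N _ => ‖w N * (expPow τ (α * (N : ℝ) ^ 2) * expPow 0 ((N : ℝ) / 2))‖) ?_ ?_ ?_ ?_ ?_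
  · have hF : ∀ N : ℤ, ∫ x in (0 : ℝ)..2, w N * (expPow τ (α * (N : ℝ) ^ 2)) *
        expPow (x : ℂ) (((N - n : ℤ) : ℝ) / 2)
        = if N = n then w n * (expPow τ (α * (n : ℝ) ^ 2)) * 2 else 0 := by
      intro N
      rw [intervalIntegral.integral_const_mul, integral_expPow_half]
      by_cases hN : N = n
      · simp [hN]
      · simp [hN, sub_eq_zero]
    simp_rw [hF] at key
    have := key.unique (hasSum_ite_eq n _)
    simp only [intervalIntegral.integral_zero] at this
    have h2 := expPow_ne_zero τ (α * (n : ℝ) ^ 2)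
    have h3 : w n * expPow τ (α * (n : ℝ) ^ 2) * 2 = 0 := this.symm
    simpa [h2] using h3
  · intro N
    refine Continuous.aestronglyMeasurable ?_
    simp only [expPow]
    fun_prop
  · intro N
    refine Filter.Eventually.of_forall fun x _ => le_of_eq ?_
    simp only [norm_mul, norm_expPow]
    simp
  · exact Filter.Eventually.of_forall fun x _ => hb
  · exact intervalIntegrable_const
  · refine Filter.Eventually.of_forall fun x _ => ?_
    have hs := (summable_norm_wsum hw hα τ x).of_norm.hasSum
    rw [← wsum, h] at hs
    have := hs.mul_right (expPow (x : ℂ) (-(n : ℝ) / 2))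
    rw [zero_mul] at this
    refine this.congr_fun ?_
    intro N
    rw [show (((N - n : ℤ) : ℝ) / 2) = (N : ℝ) / 2 + -(n : ℝ) / 2 by push_cast; ring,
      expPow_add]
    ring

/-- The product of two weighted theta series: summing `α m ^ 2 + β (N - m) ^ 2` over `m`
leaves the Gaussian `α β / (α + β) * N ^ 2` after completing the square. -/
lemma wsum_mul_wsum {w v : ℤ → ℂ} {C D : ℝ} (hw : ∀ N, ‖w N‖ ≤ C) (hv : ∀ N, ‖v N‖ ≤ D)
    {α β : ℝ} (hα : 0 < α) (hβ : 0 < β) (τ : ℍ) (z : ℂ) :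
    let E : ℤ → ℂ := fun N => ∑' m : ℤ, w m * v (N - m) *
      expPow τ ((α + β) * ((m : ℝ) - β / (α + β) * N) ^ 2)
    HasSum (fun N : ℤ => E N * (expPow τ (α * β / (α + β) * (N : ℝ) ^ 2) *
      expPow z ((N : ℝ) / 2))) (wsum w α τ z * wsum v β τ z) := by
  intro E
  have h1 := summable_norm_wsum hw hα τ z
  have h2 := summable_norm_wsum hv hβ τ z
  let e : ℤ × ℤ ≃ ℤ × ℤ :=
    { toFun := fun p => (p.2, p.1 - p.2)
      invFun := fun p => (p.1 + p.2, p.1)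
      left_inv := fun p => by simp
      right_inv := fun p => by simp }
  have h3 := (Summable.mul_norm h1 h2).of_norm.hasSum
  rw [← tsum_mul_tsum_of_summable_norm h1 h2, ← e.hasSum_iff] at h3
  have h4 := h3.summable
  refine (h3.prod_fiberwise (g := fun N => E N * (expPow τ (α * β / (α + β) * (N : ℝ) ^ 2) *
      expPow z ((N : ℝ) / 2))) fun N => ?_)
  have h5 := (h4.prod_factor N).hasSum
  convert h5 using 1
  rw [← tsum_mul_right]
  refine tsum_congr fun m => ?_
  have hne : α + β ≠ 0 := by positivity
  have e1 : expPow τ ((α + β) * ((m : ℝ) - β / (α + β) * N) ^ 2) *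
      expPow τ (α * β / (α + β) * (N : ℝ) ^ 2) =
      expPow τ (α * (m : ℝ) ^ 2) * expPow τ (β * ((N - m : ℤ) : ℝ) ^ 2) := by
    rw [← expPow_add, ← expPow_add]
    congr 1
    push_cast
    field_simp
    ring
  have e2 : expPow z ((N : ℝ) / 2) = expPow z ((m : ℝ) / 2) * expPow z (((N - m : ℤ) : ℝ) / 2) := by
    rw [← expPow_add]
    congr 1
    push_cast
    ring
  simp only [Function.comp, e, Equiv.coe_fn_mk]
  rw [e2]
  linear_combination (w m * v (N - m) * expPow z ((m : ℝ) / 2) *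
    expPow z (((N - m : ℤ) : ℝ) / 2)) * e1

/-- A product of entire functions of one variable vanishes identically only if a factor does. -/
lemma eq_zero_or_eq_zero_of_entire {f g : ℂ → ℂ} (hf : Differentiable ℂ f)
    (hg : Differentiable ℂ g) (h : ∀ z, f z * g z = 0) : (∀ z, f z = 0) ∨ ∀ z, g z = 0 := by
  have := AnalyticOnNhd.eq_zero_or_eq_zero_of_mul_eq_zero (U := Set.univ) (f := f) (g := g)
    (fun z _ => hf.analyticAt z) (fun z _ => hg.analyticAt z) (fun z _ => h z)
    isPreconnected_univ
  simpa using this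


/-! ### Theta functions as weighted theta series -/

/-- The indicator function of the residue class of `c` modulo `p`. -/
def residueInd (p c N : ℤ) : ℂ := if N ≡ c [ZMOD p] then 1 else 0

lemma residueInd_eq_one {p c N : ℤ} (h : N % p = c % p) : residueInd p c N = 1 := if_pos h

lemma residueInd_eq_zero {p c N : ℤ} (h : N % p ≠ c % p) : residueInd p c N = 0 := if_neg h

lemma norm_residueInd_le (p c N : ℤ) : ‖residueInd p c N‖ ≤ 1 := by
  rw [residueInd]
  split_ifs <;> simp

lemma residueInd_neg (p c N : ℤ) : residueInd p c (-N) = residueInd p (-c) N := by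
  rw [residueInd, residueInd]
  congr 1
  rw [eq_iff_iff]
  exact ⟨fun h => by simpa using h.neg, fun h => by simpa using h.neg⟩

lemma residueInd_add_period (p c N : ℤ) : residueInd p c (N + p) = residueInd p c N := by
  rw [residueInd, residueInd]
  congr 1
  simp [Int.ModEq]

lemma theta_eq_wsum {k : ℕ} (hk : 1 ≤ k) (n : ℤ) (τ : ℍ) (z : ℂ) :
    theta k n τ z = wsum (residueInd (2 * k) n) (1 / (4 * k)) τ z := by
  have hk0 : (k : ℝ) ≠ 0 := by positivity
  have h2k : (2 * (k : ℤ)) ≠ 0 := by positivity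
  have h := tsum_progression h2k n fun N : ℤ =>
    expPow τ (1 / (4 * (k : ℝ)) * (N : ℝ) ^ 2) * expPow z ((N : ℝ) / 2)
  rw [theta, wsum]
  simp only [residueInd]
  rw [← h]
  refine tsum_congr fun m => ?_
  congr 2
  · push_cast
    field_simp
    ring
  · push_cast
    field_simp

lemma thetaSym_eq_wsum {k : ℕ} (hk : 1 ≤ k) (n : ℤ) (τ : ℍ) (z : ℂ) :
    thetaSym k n τ z =
      wsum (fun N => residueInd (2 * k) n N + residueInd (2 * k) (-n) N) (1 / (4 * k)) τ z := by
  rw [thetaSym, theta_eq_wsum hk, theta_eq_wsum hk,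
    wsum_add (norm_residueInd_le _ _) (norm_residueInd_le _ _) (by positivity)]

/-- The nontrivial Dirichlet character modulo `4`, with complex values. -/
def signFour (N : ℤ) : ℂ := residueInd 4 1 N - residueInd 4 (-1) N

lemma norm_signFour_le (N : ℤ) : ‖signFour N‖ ≤ 2 := by
  have h := norm_sub_le (residueInd 4 1 N) (residueInd 4 (-1) N)
  have h1 := norm_residueInd_le 4 1 N
  have h2 := norm_residueInd_le 4 (-1) N
  rw [signFour]
  linarith

lemma signFour_neg (N : ℤ) : signFour (-N) = -signFour N := by
  rw [signFour, signFour, residueInd_neg, residueInd_neg]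
  simp

lemma signFour_add_four (N : ℤ) : signFour (N + 4) = signFour N := by
  rw [signFour, signFour, residueInd_add_period, residueInd_add_period]

lemma signFour_even (t : ℤ) : signFour (2 * t) = 0 := by
  rw [signFour, residueInd, residueInd, if_neg, if_neg, sub_zero] <;>
  · simp only [Int.ModEq]
    omega

lemma signFour_odd (t : ℤ) : signFour (2 * t + 1) = (-1 : ℂ) ^ t := by
  rw [signFour, residueInd, residueInd]
  obtain ⟨s, rfl | rfl⟩ := Int.even_or_odd' t
  · rw [if_pos, if_neg, zpow_mul]
    · simp
    all_goals simp only [Int.ModEq]; omega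
  · rw [if_neg, if_pos, zpow_add₀ (by simp), zpow_mul]
    · simp
    all_goals simp only [Int.ModEq]; omega

lemma charDenom_eq_wsum (τ : ℍ) (z : ℂ) : charDenom τ z = wsum signFour (1 / 8) τ z := by
  have h := wsum_sub (norm_residueInd_le 4 1) (norm_residueInd_le 4 (-1))
    (α := 1 / 8) (by norm_num) τ z
  rw [charDenom, theta_eq_wsum (by norm_num), theta_eq_wsum (by norm_num)]
  norm_num at h ⊢
  rw [← h]
  rfl

lemma differentiable_charDenom (τ : ℍ) : Differentiable ℂ (charDenom τ) := by
  rw [show charDenom τ = wsum signFour (1 / 8) τ from funext (charDenom_eq_wsum τ)]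
  exact differentiable_wsum norm_signFour_le (by norm_num) τ

lemma charDenom_not_identically_zero (τ : ℍ) : ¬ ∀ z, charDenom τ z = 0 := by
  intro h
  have := wsum_eq_zero norm_signFour_le (α := 1 / 8) (by norm_num)
    (fun z => (charDenom_eq_wsum τ z).symm.trans (h z)) (2 * 0 + 1)
  rw [signFour_odd] at this
  simp at this

/-! ### Expansion of theta functions in affine characters -/

lemma summable_heckeTerm {k : ℕ} (hk : 1 ≤ k) (l : ℕ) (τ : ℍ) :
    Summable fun m : ℤ => ‖heckeTerm k l τ m‖ := by
  have hk0 : (k : ℝ) ≠ 0 := by positivity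
  have hα : 0 < ((k : ℝ) + 2) / (8 * k) := by positivity
  refine (summable_norm_expPow_mul hα (((l : ℝ) + 1) / 4)
    ((k : ℝ) * ((l : ℝ) + 1) ^ 2 / (8 * (k + 2))) 0 0 τ 0).congr fun m => ?_
  rw [expPow_zero_left, mul_one, heckeTerm]
  congr 2
  field_simp
  ring

lemma summable_residueInd_mul_heckeTerm {k : ℕ} (hk : 1 ≤ k) (p c : ℤ) (s : ℤ → ℂ)
    (hs : ∀ m, ‖s m‖ = 1) (l : ℕ) (τ : ℍ) :
    Summable fun m : ℤ => residueInd p c m * (s m * heckeTerm k l τ m) := by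
  refine Summable.of_norm_bounded (summable_heckeTerm hk l τ) fun m => ?_
  rw [norm_mul, norm_mul, hs, one_mul]
  exact mul_le_of_le_one_left (norm_nonneg _) (norm_residueInd_le _ _ _)

lemma norm_neg_one_zpow (t : ℤ) : ‖(-1 : ℂ) ^ t‖ = 1 := by simp

lemma transHalf_eq_tsum (k : ℕ) (n : ℤ) (l : ℕ) (τ : ℍ) :
    transHalf k n l τ = ∑' m : ℤ, residueInd (2 * k) n m *
      ((-1 : ℂ) ^ (((l : ℤ) + m) / 2) * heckeTerm k l τ m) := by
  have h := tsum_subtype {m : ℤ | m ≡ n [ZMOD 2 * (k : ℤ)]}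
    fun m : ℤ => (-1 : ℂ) ^ (((l : ℤ) + m) / 2) * heckeTerm k l τ m
  rw [transHalf]
  refine h.trans (tsum_congr fun m => ?_)
  rw [Set.indicator_apply, residueInd]
  simp only [Set.mem_ofPred_eq]
  split_ifs <;> simp

/-- The coefficient of `q ^ (N ^ 2 / (4 (k + 2))) r ^ (N / 2)` in the product of `M_{k,n}` with the
character denominator. -/
def productCoeff (k : ℕ) (n : ℤ) (τ : ℍ) (N : ℤ) : ℂ :=
  ∑' m : ℤ, (residueInd (2 * k) n m + residueInd (2 * k) (-n) m) * signFour (N - m) *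
    expPow τ ((1 / (4 * k) + 1 / 8) * ((m : ℝ) - 1 / 8 / (1 / (4 * k) + 1 / 8) * N) ^ 2)

lemma productCoeff_neg (k : ℕ) (n : ℤ) (τ : ℍ) (N : ℤ) :
    productCoeff k n τ (-N) = -productCoeff k n τ N := by
  rw [productCoeff, productCoeff, ← tsum_neg, ← (Equiv.neg ℤ).tsum_eq]
  refine tsum_congr fun m => ?_
  simp only [Equiv.neg_apply]
  rw [residueInd_neg, residueInd_neg, neg_neg, show -N - -m = -(N - m) by ring, signFour_neg]
  push_cast
  ring_nf

lemma productCoeff_add_period {k : ℕ} (hk : 1 ≤ k) (n : ℤ) (τ : ℍ) (N : ℤ) :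
    productCoeff k n τ (N + 2 * (k + 2)) = productCoeff k n τ N := by
  have hk0 : (k : ℝ) ≠ 0 := by positivity
  have hk2 : (k : ℝ) + 2 ≠ 0 := by positivity
  rw [productCoeff, productCoeff, ← (Equiv.addRight (2 * (k : ℤ))).tsum_eq]
  refine tsum_congr fun m => ?_
  simp only [Equiv.coe_addRight]
  rw [residueInd_add_period, residueInd_add_period,
    show N + 2 * ((k : ℤ) + 2) - (m + 2 * k) = N - m + 4 by ring, signFour_add_four]
  congr 3
  push_cast
  field_simp
  ring

/-- An odd function with period `2 (k + 2)` is supported on the classes of `± (l + 1)` with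
`0 ≤ l ≤ k`. -/
lemma odd_periodic_eq_sum {E : ℤ → ℂ} {k : ℕ} (hodd : ∀ N, E (-N) = -E N)
    (hper : ∀ N, E (N + 2 * (k + 2)) = E N) (N : ℤ) :
    E N = ∑ l ∈ Finset.range (k + 1), E (l + 1) *
      (residueInd (2 * (k + 2 : ℕ)) (l + 1) N - residueInd (2 * (k + 2 : ℕ)) (-l - 1) N) := by
  have hper' : Function.Periodic E (2 * (k + 2)) := hper
  set p : ℤ := 2 * (k + 2) with hp
  have hp' : (2 * ((k + 2 : ℕ) : ℤ)) = p := by rw [hp]; push_cast; ring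
  have hmod : E N = E (N % p) := by
    conv_lhs => rw [← Int.emod_add_mul_ediv N p, mul_comm]
    exact hper'.int_mul _ _
  have hr0 := Int.emod_nonneg N (show p ≠ 0 by omega)
  have hr1 := Int.emod_lt_of_pos N (show 0 < p by omega)
  rw [hp', hmod]
  set r := N % p with hr
  have h1 : ∀ l ∈ Finset.range (k + 1), E ((l : ℤ) + 1) *
      (residueInd p (l + 1) N - residueInd p (-l - 1) N) =
      E ((l : ℤ) + 1) * ((if r = l + 1 then 1 else 0) - if r = p - (l + 1) then 1 else 0) := by
    intro l hl
    rw [Finset.mem_range] at hl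
    have e1 : N ≡ l + 1 [ZMOD p] ↔ r = l + 1 := by
      rw [Int.ModEq, ← hr, Int.emod_eq_of_lt (by omega) (by omega)]
    have e2 : N ≡ -l - 1 [ZMOD p] ↔ r = p - (l + 1) := by
      rw [Int.ModEq, ← hr, ← Int.add_emod_right, Int.emod_eq_of_lt (by omega) (by omega)]
      constructor <;> intro h <;> omega
    simp only [residueInd, e1, e2]
  rw [Finset.sum_congr rfl h1]
  have hEz : E 0 = 0 := by
    have := hodd 0
    rw [neg_zero] at this
    linear_combination this / 2
  have hEmid : E (k + 2) = 0 := by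
    have h := hper (-(k + 2))
    rw [show -((k : ℤ) + 2) + p = k + 2 by omega, hodd] at h
    linear_combination h / 2
  by_cases hA : 1 ≤ r ∧ r ≤ k + 1
  · rw [Finset.sum_eq_single (r - 1).toNat]
    · have : (((r - 1).toNat : ℕ) : ℤ) = r - 1 := by omega
      rw [this, if_pos (by ring), if_neg (by omega)]
      simp
    · intro l hl hne
      rw [Finset.mem_range] at hl
      rw [if_neg (by omega), if_neg (by omega)]
      simp
    · intro h
      rw [Finset.mem_range] at h
      omega
  · by_cases hB : k + 3 ≤ r
    · rw [Finset.sum_eq_single (p - r - 1).toNat]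
      · have : (((p - r - 1).toNat : ℕ) : ℤ) = p - r - 1 := by omega
        rw [this, if_neg (by omega), if_pos (by ring)]
        have h := hper (-(p - r - 1 + 1))
        rw [show -(p - r - 1 + 1) + p = r by ring, hodd] at h
        rw [h]
        ring
      · intro l hl hne
        rw [Finset.mem_range] at hl
        rw [if_neg (by omega), if_neg (by omega)]
        simp
      · intro h
        rw [Finset.mem_range] at h
        omega
    · rw [Finset.sum_eq_zero]
      · have : r = 0 ∨ r = k + 2 := by omega
        rcases this with h | h <;> rw [h]
        · exact hEz
        · exact hEmid
      · intro l hl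
        rw [Finset.mem_range] at hl
        rw [if_neg (by omega), if_neg (by omega)]
        simp

lemma thetaSym_mul_charDenom {k : ℕ} (hk : 1 ≤ k) (n : ℤ) (τ : ℍ) (z : ℂ) :
    thetaSym k n τ z * charDenom τ z = ∑ l ∈ Finset.range (k + 1),
      productCoeff k n τ (l + 1) *
        (theta (k + 2) (l + 1) τ z - theta (k + 2) (-l - 1) τ z) := by
  have hk0 : (k : ℝ) ≠ 0 := by positivity
  have hw : ∀ N, ‖residueInd (2 * k) n N + residueInd (2 * k) (-n) N‖ ≤ (2 : ℝ) := fun N => by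
    have h := norm_add_le (residueInd (2 * k) n N) (residueInd (2 * k) (-n) N)
    have h1 := norm_residueInd_le (2 * k) n N
    have h2 := norm_residueInd_le (2 * k) (-n) N
    linarith
  have h := wsum_mul_wsum hw norm_signFour_le (α := 1 / (4 * k)) (β := 1 / 8) (by positivity)
    (by norm_num) τ z
  rw [← thetaSym_eq_wsum hk, ← charDenom_eq_wsum] at h
  rw [← h.tsum_eq]
  have hγ : 1 / (4 * (k : ℝ)) * (1 / 8) / (1 / (4 * k) + 1 / 8) = 1 / (4 * (k + 2 : ℕ)) := by
    push_cast
    field_simp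
    ring
  rw [hγ]
  have hsum : ∀ l ∈ Finset.range (k + 1), Summable fun N : ℤ =>
      productCoeff k n τ (l + 1) *
        ((residueInd (2 * (k + 2 : ℕ)) (l + 1) N - residueInd (2 * (k + 2 : ℕ)) (-l - 1) N) *
        (expPow τ (1 / (4 * (k + 2 : ℕ)) * (N : ℝ) ^ 2) * expPow z ((N : ℝ) / 2))) := by
    intro l _
    refine Summable.mul_left _ ?_
    refine (summable_norm_wsum (C := 2) (fun N => ?_) (by positivity) τ z).of_norm
    have h := norm_sub_le (residueInd (2 * (k + 2 : ℕ)) (l + 1) N)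
      (residueInd (2 * (k + 2 : ℕ)) (-l - 1) N)
    have h1 := norm_residueInd_le (2 * (k + 2 : ℕ)) (l + 1) N
    have h2 := norm_residueInd_le (2 * (k + 2 : ℕ)) (-l - 1) N
    linarith
  calc _ = ∑' N : ℤ, ∑ l ∈ Finset.range (k + 1), productCoeff k n τ (l + 1) *
        ((residueInd (2 * (k + 2 : ℕ)) (l + 1) N - residueInd (2 * (k + 2 : ℕ)) (-l - 1) N) *
        (expPow τ (1 / (4 * (k + 2 : ℕ)) * (N : ℝ) ^ 2) * expPow z ((N : ℝ) / 2))) := by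
        refine tsum_congr fun N => ?_
        have := odd_periodic_eq_sum (productCoeff_neg k n τ) (productCoeff_add_period hk n τ) N
        rw [productCoeff] at this
        beta_reduce
        rw [this, Finset.sum_mul]
        exact Finset.sum_congr rfl fun l _ => by ring
    _ = _ := by
        rw [Summable.tsum_finsetSum hsum]
        refine Finset.sum_congr rfl fun l _ => ?_
        rw [tsum_mul_left, theta_eq_wsum (by omega), theta_eq_wsum (by omega),
          ← wsum_sub (norm_residueInd_le _ _) (norm_residueInd_le _ _) (by positivity)]
        rfl

/-- The coefficient of the product at `N = l + 1` is the coefficient `D^{(k)}_{n,l}`: substitute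
`m ↦ -m`. -/
lemma productCoeff_eq_transCoeff {k : ℕ} (hk : 1 ≤ k) (n : ℤ) (l : ℕ)
    (hl : (l : ℤ) ≡ n [ZMOD 2]) (τ : ℍ) :
    productCoeff k n τ (l + 1) = transCoeff k n l τ := by
  have hk0 : (k : ℝ) ≠ 0 := by positivity
  have hk2 : (k : ℝ) + 2 ≠ 0 := by positivity
  rw [transCoeff, transHalf_eq_tsum, transHalf_eq_tsum, ← Summable.tsum_add
    (summable_residueInd_mul_heckeTerm hk _ _ _ (fun m => norm_neg_one_zpow _) l τ)
    (summable_residueInd_mul_heckeTerm hk _ _ _ (fun m => norm_neg_one_zpow _) l τ),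
    productCoeff, ← (Equiv.neg ℤ).tsum_eq]
  refine tsum_congr fun m => ?_
  simp only [Equiv.neg_apply]
  rw [residueInd_neg, residueInd_neg, neg_neg, ← add_mul,
    add_comm (residueInd (2 * k) (-n) m), heckeTerm]
  have hexp : (1 / (4 * (k : ℝ)) + 1 / 8) * (((-m : ℤ) : ℝ) -
      1 / 8 / (1 / (4 * k) + 1 / 8) * ((l + 1 : ℤ) : ℝ)) ^ 2 =
      (k : ℝ) * ((k : ℝ) + 2) / 8 * ((m : ℝ) / (k : ℝ) + ((l : ℝ) + 1) / ((k : ℝ) + 2)) ^ 2 := by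
    push_cast
    field_simp
    ring
  rw [hexp]
  by_cases hm : m ≡ l [ZMOD 2]
  · have hpar : (l : ℤ) + 1 - -m = 2 * (((l : ℤ) + m) / 2) + 1 := by
      simp only [Int.ModEq] at hm
      omega
    rw [hpar, signFour_odd]
    ring
  · have h1 : ¬ m ≡ n [ZMOD 2 * (k : ℤ)] := fun h => hm ((h.of_mul_right _).trans hl.symm)
    have h2 : ¬ m ≡ -n [ZMOD 2 * (k : ℤ)] := fun h => by
      have h3 := h.of_mul_right (k : ℤ)
      simp only [Int.ModEq] at h3 hl hm
      omega
    simp [residueInd, h1, h2]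

lemma productCoeff_eq_zero {k : ℕ} (n : ℤ) (l : ℕ)
    (hl : ¬ (l : ℤ) ≡ n [ZMOD 2]) (τ : ℍ) : productCoeff k n τ (l + 1) = 0 := by
  rw [productCoeff]
  refine (tsum_congr fun m => ?_).trans tsum_zero
  by_cases hm : m ≡ l [ZMOD 2]
  · have h1 : ¬ m ≡ n [ZMOD 2 * (k : ℤ)] := fun h => hl (hm.symm.trans (h.of_mul_right _))
    have h2 : ¬ m ≡ -n [ZMOD 2 * (k : ℤ)] := fun h => by
      have h3 := h.of_mul_right (k : ℤ)
      simp only [Int.ModEq] at h3 hl hm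
      omega
    simp [residueInd, h1, h2]
  · have hpar : (l : ℤ) + 1 - m = 2 * (((l : ℤ) + 1 - m) / 2) := by
      simp only [Int.ModEq] at hm
      omega
    rw [hpar, signFour_even]
    simp

/-- The expansion of `M_{k,n}` in affine characters. -/
theorem thetaSym_eq_sum_transCoeff_mul_chi {k : ℕ} (hk : 1 ≤ k) (n : ℤ) (τ : ℍ) (z : ℂ)
    (hz : charDenom τ z ≠ 0) :
    thetaSym k n τ z = ∑ l ∈ (Finset.range (k + 1)).filter (fun l : ℕ => (l : ℤ) ≡ n [ZMOD 2]),
      transCoeff k n l τ * chi k l τ z := by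
  have h := thetaSym_mul_charDenom hk n τ z
  rw [← eq_div_iff hz] at h
  rw [h, Finset.sum_div, Finset.sum_filter]
  refine Finset.sum_congr rfl fun l _ => ?_
  split_ifs with hl
  · rw [productCoeff_eq_transCoeff hk n l hl, chi, mul_div_assoc]
  · rw [productCoeff_eq_zero n l hl, zero_mul, zero_div]


/-! ### The coefficients at level 24 -/

/-- The indicator function of the classes of `± c` modulo `24`. -/
def pairInd (c m : ℤ) : ℂ := if m ≡ c [ZMOD 24] ∨ m ≡ -c [ZMOD 24] then 1 else 0

lemma classSum_eq_tsum (c : ℤ) (l : ℕ) (τ : ℍ) :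
    classSum c l τ = ∑' m : ℤ, pairInd c m * heckeTerm 24 l τ m := by
  have h := tsum_subtype {m : ℤ | m ≡ c [ZMOD 24] ∨ m ≡ -c [ZMOD 24]}
    fun m : ℤ => expPow τ (78 * ((m : ℝ) / 24 + ((l : ℝ) + 1) / 26) ^ 2)
  rw [classSum]
  refine h.trans (tsum_congr fun m => ?_)
  rw [Set.indicator_apply, pairInd, heckeTerm]
  simp only [Set.mem_ofPred_eq]
  norm_num

/-- The four classes `± c, ± (24 - c)` modulo `48` make up the classes of `± c` modulo `24`, and on
them the sign `(-1) ^ ((l + m) / 2)` is constant, because `m / 2` is odd. -/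
lemma transCoeff_add_transCoeff {c : ℤ} (hc : c % 4 = 2) {l : ℕ} (hl : Even l) (τ : ℍ) :
    transCoeff 24 c l τ + transCoeff 24 (24 - c) l τ = -(-1 : ℂ) ^ (l / 2) * classSum c l τ := by
  have hs := fun c' : ℤ => summable_residueInd_mul_heckeTerm (k := 24) (by norm_num)
    (2 * (24 : ℕ)) c' (fun m : ℤ => (-1 : ℂ) ^ (((l : ℤ) + m) / 2))
    (fun m => norm_neg_one_zpow _) l τ
  simp only [transCoeff, transHalf_eq_tsum]
  rw [← (hs _).tsum_add (hs _), ← (hs _).tsum_add (hs _),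
    ← ((hs _).add (hs _)).tsum_add ((hs _).add (hs _)), classSum_eq_tsum, ← tsum_mul_left]
  refine tsum_congr fun m => ?_
  have hind : residueInd (2 * (24 : ℕ)) c m + residueInd (2 * (24 : ℕ)) (-c) m +
      (residueInd (2 * (24 : ℕ)) (24 - c) m + residueInd (2 * (24 : ℕ)) (-(24 - c)) m) =
      pairInd c m := by
    rw [show (2 * (24 : ℕ) : ℤ) = 48 by norm_num]
    by_cases h : m % 24 = c % 24 ∨ m % 24 = -c % 24
    · rw [show pairInd c m = 1 from if_pos h]
      have h5 : m % 48 = c % 48 ∨ m % 48 = -c % 48 ∨ m % 48 = (24 - c) % 48 ∨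
        m % 48 = -(24 - c) % 48 := by omega
      rcases h5 with h5 | h5 | h5 | h5
      · rw [residueInd_eq_one h5, residueInd_eq_zero (by omega), residueInd_eq_zero (by omega),
          residueInd_eq_zero (by omega)]
        norm_num
      · rw [residueInd_eq_one h5, residueInd_eq_zero (by omega), residueInd_eq_zero (by omega),
          residueInd_eq_zero (by omega)]
        norm_num
      · rw [residueInd_eq_one h5, residueInd_eq_zero (by omega), residueInd_eq_zero (by omega),
          residueInd_eq_zero (by omega)]
        norm_num
      · rw [residueInd_eq_one h5, residueInd_eq_zero (by omega), residueInd_eq_zero (by omega),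
          residueInd_eq_zero (by omega)]
        norm_num
    · rw [show pairInd c m = 0 from if_neg h, residueInd_eq_zero (by omega),
        residueInd_eq_zero (by omega), residueInd_eq_zero (by omega),
        residueInd_eq_zero (by omega)]
      norm_num
  have hsign : pairInd c m * (-1 : ℂ) ^ (((l : ℤ) + m) / 2) =
      pairInd c m * -(-1 : ℂ) ^ (l / 2) := by
    rw [pairInd]
    split_ifs with h
    · obtain ⟨j, rfl⟩ := hl
      have h4 : m % 4 = 2 := by
        simp only [Int.ModEq] at h
        omega
      have e : (((j + j : ℕ) : ℤ) + m) / 2 = (j : ℤ) + (2 * (m / 4) + 1) := by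
        push_cast
        omega
      have e2 : (j + j) / 2 = j := by omega
      rw [e, e2, zpow_add₀ (by simp), zpow_add₀ (by simp), zpow_mul]
      simp
    · simp
  linear_combination ((-1 : ℂ) ^ (((l : ℤ) + m) / 2) * heckeTerm 24 l τ m) * hind +
    heckeTerm 24 l τ m * hsign

lemma sum_transCoeff_eq {l : ℕ} (hl : Even l) (τ : ℍ) :
    (transCoeff 24 2 l τ + transCoeff 24 22 l τ - transCoeff 24 10 l τ - transCoeff 24 14 l τ) /
      eta τ = explicitCoeff l τ := by
  have h2 := transCoeff_add_transCoeff (c := 2) (by norm_num) hl τ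
  have h10 := transCoeff_add_transCoeff (c := 10) (by norm_num) hl τ
  norm_num at h2 h10
  rw [explicitCoeff]
  congr 1
  linear_combination h2 - h10

lemma classSum_reflect {l : ℕ} (hl : l ≤ 24) (c : ℤ) (τ : ℍ) :
    classSum c (24 - l) τ = classSum c l τ := by
  rw [classSum_eq_tsum, classSum_eq_tsum, ← (Equiv.subLeft (-24 : ℤ)).tsum_eq]
  refine tsum_congr fun m => ?_
  simp only [Equiv.subLeft_apply]
  have h1 : pairInd c (-24 - m) = pairInd c m := by
    rw [pairInd, pairInd]
    congr 1
    rw [eq_iff_iff]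
    simp only [Int.ModEq]
    omega
  rw [h1, heckeTerm, heckeTerm]
  congr 2
  push_cast [Nat.cast_sub hl]
  ring

/-- The coefficients are symmetric under `l ↦ 24 - l`. -/
lemma explicitCoeff_reflect {l : ℕ} (hl : l ≤ 24) (he : Even l) (τ : ℍ) :
    explicitCoeff (24 - l) τ = explicitCoeff l τ := by
  rw [explicitCoeff, explicitCoeff, classSum_reflect hl, classSum_reflect hl]
  congr 2
  obtain ⟨j, rfl⟩ := he
  have e1 : (j + j) / 2 = j := by omega
  have e2 : (24 - (j + j)) / 2 = 12 - j := by omega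
  rw [e1, e2, ← mul_left_inj' (pow_ne_zero j (show (-1 : ℂ) ≠ 0 by simp)), ← pow_add, ← pow_add,
    show 12 - j + j = 12 by omega, ← two_mul, pow_mul]
  norm_num

lemma eta_ne_zero (τ : ℍ) : eta τ ≠ 0 := ModularForm.eta_ne_zero τ.im_pos

/-! ### Linear independence of the characters -/

lemma chi_mul_charDenom (k l : ℕ) (τ : ℍ) (z : ℂ) (hz : charDenom τ z ≠ 0) :
    chi k l τ z * charDenom τ z = wsum (fun N => residueInd (2 * (k + 2 : ℕ)) (l + 1) N -
      residueInd (2 * (k + 2 : ℕ)) (-l - 1) N) (1 / (4 * (k + 2 : ℕ))) τ z := by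
  rw [chi, div_mul_cancel₀ _ hz, theta_eq_wsum (by omega), theta_eq_wsum (by omega),
    ← wsum_sub (norm_residueInd_le _ _) (norm_residueInd_le _ _) (by positivity)]

/-- For fixed `τ` the characters of level `k` are linearly independent functions of `z`: the
numerators involve disjoint sets of Fourier modes. -/
lemma chi_linearIndependent (k : ℕ) (c : ℕ → ℂ) (τ : ℍ)
    (h : ∀ z, charDenom τ z ≠ 0 → ∑ l ∈ Finset.range (k + 1), c l * chi k l τ z = 0)
    {j : ℕ} (hj : j ≤ k) : c j = 0 := by
  set v : ℕ → ℤ → ℂ := fun l N => residueInd (2 * (k + 2 : ℕ)) (l + 1) N -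
      residueInd (2 * (k + 2 : ℕ)) (-l - 1) N with hv
  have hvb : ∀ l N, ‖v l N‖ ≤ 2 := fun l N => by
    have h := norm_sub_le (residueInd (2 * (k + 2 : ℕ)) (l + 1) N)
      (residueInd (2 * (k + 2 : ℕ)) (-l - 1) N)
    have h1 := norm_residueInd_le (2 * (k + 2 : ℕ)) (l + 1) N
    have h2 := norm_residueInd_le (2 * (k + 2 : ℕ)) (-l - 1) N
    simp only [hv]
    linarith
  set w : ℤ → ℂ := fun N => ∑ l ∈ Finset.range (k + 1), c l * v l N with hw
  have hwb : ∀ N, ‖w N‖ ≤ ∑ l ∈ Finset.range (k + 1), ‖c l‖ * 2 := fun N =>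
    norm_sum_le_of_le _ fun l _ => by
      rw [norm_mul]
      exact mul_le_mul_of_nonneg_left (hvb l N) (norm_nonneg _)
  have hα : (0 : ℝ) < 1 / (4 * (k + 2 : ℕ)) := by positivity
  have hwsum : ∀ z, wsum w (1 / (4 * (k + 2 : ℕ))) τ z =
      ∑ l ∈ Finset.range (k + 1), c l * wsum (v l) (1 / (4 * (k + 2 : ℕ))) τ z := fun z => by
    simp only [wsum, hw]
    simp_rw [Finset.sum_mul, mul_assoc]
    rw [Summable.tsum_finsetSum fun l _ =>
      ((summable_norm_wsum (hvb l) hα τ z).of_norm).mul_left (c l)]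
    simp_rw [tsum_mul_left]
  -- The relation holds off the zeros of the denominator; after multiplication by the denominator
  -- it holds everywhere, and an entire factor can be cancelled.
  have hprod : ∀ z, charDenom τ z * wsum w (1 / (4 * (k + 2 : ℕ))) τ z = 0 := by
    intro z
    by_cases hz : charDenom τ z = 0
    · rw [hz, zero_mul]
    · rw [hwsum, ← mul_zero (charDenom τ z), ← mul_zero (charDenom τ z), ← h z hz]
      congr 1
      rw [Finset.mul_sum]
      refine Finset.sum_congr rfl fun l _ => ?_
      rw [← chi_mul_charDenom k l τ z hz]
      ring
  have hzero := (eq_zero_or_eq_zero_of_entire (differentiable_charDenom τ)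
    (differentiable_wsum hwb hα τ) hprod).resolve_left (charDenom_not_identically_zero τ)
  have hcoef := wsum_eq_zero hwb hα hzero (j + 1)
  simp only [hw] at hcoef
  rw [Finset.sum_eq_single j] at hcoef
  · have h1 : v j (j + 1) = 1 := by
      simp only [hv, residueInd]
      rw [if_pos (Int.ModEq.refl _), if_neg, sub_zero]
      intro h
      have := Int.le_of_dvd (by omega) (Int.modEq_iff_dvd.mp h.symm)
      push_cast at this
      omega
    rwa [h1, mul_one] at hcoef
  · intro l hl hne
    rw [Finset.mem_range] at hl
    have h1 : v l (j + 1) = 0 := by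
      simp only [hv, residueInd]
      rw [if_neg, if_neg, sub_zero]
      · intro h
        have := Int.le_of_dvd (by omega) (Int.modEq_iff_dvd.mp h.symm)
        push_cast at this
        omega
      · intro h
        have := Int.eq_zero_of_abs_lt_dvd (Int.modEq_iff_dvd.mp h) (by
          rw [abs_lt]
          push_cast
          constructor <;> omega)
        omega
    rw [h1, mul_zero]
  · intro h
    exact absurd (Finset.mem_range.mpr (by omega)) h


/-! ### Euler's pentagonal number theorem and the eta function -/

lemma norm_prod_one_sub_pow_le {x : ℂ} (hx : ‖x‖ < 1) (k n : ℕ) :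
    ‖∏ i ∈ Finset.range (n + 1), (1 - x ^ (k + i + 1))‖ ≤ Real.exp (1 - ‖x‖)⁻¹ := by
  calc ‖∏ i ∈ Finset.range (n + 1), (1 - x ^ (k + i + 1))‖
      ≤ ∏ i ∈ Finset.range (n + 1), Real.exp (‖x‖ ^ i) := by
        rw [norm_prod]
        refine Finset.prod_le_prod (fun _ _ => norm_nonneg _) fun i _ => ?_
        calc ‖1 - x ^ (k + i + 1)‖ ≤ ‖(1 : ℂ)‖ + ‖x ^ (k + i + 1)‖ := norm_sub_le _ _
          _ = ‖x‖ ^ (k + i + 1) + 1 := by rw [norm_one, norm_pow, add_comm]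
          _ ≤ ‖x‖ ^ i + 1 := by
            gcongr ?_ + 1
            exact pow_le_pow_of_le_one (norm_nonneg _) hx.le (by omega)
          _ ≤ _ := Real.add_one_le_exp _
    _ = Real.exp (∑ i ∈ Finset.range (n + 1), ‖x‖ ^ i) := (Real.exp_sum _ _).symm
    _ ≤ _ := by
        rw [Real.exp_le_exp, ← tsum_geometric_of_lt_one (norm_nonneg x) hx]
        exact (summable_geometric_of_lt_one (norm_nonneg x) hx).sum_le_tsum _
          fun _ _ => by positivity

lemma le_pentagonal_neg (k : ℕ) : k ≤ pentagonal (-k) := by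
  have h := two_mul_natCast_pentagonal_neg k
  nlinarith

lemma le_pentagonal_add_one (k : ℕ) : k ≤ pentagonal (k + 1) := by
  have h := two_mul_natCast_pentagonal (k + 1)
  nlinarith

/-- Euler's pentagonal number theorem on the open unit disc. -/
theorem hasSum_pentagonal {x : ℂ} (hx : ‖x‖ < 1) :
    HasSum (fun k : ℤ => (-1 : ℂ) ^ k * x ^ pentagonal (-k)) (∏' n : ℕ, (1 - x ^ (n + 1))) := by
  have hgeo := summable_geometric_of_lt_one (norm_nonneg x) hx
  set B := Real.exp (1 - ‖x‖)⁻¹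
  have hterm : ∀ k n : ℕ, ‖x ^ ((k + 1) * n) * ∏ i ∈ Finset.range (n + 1), (1 - x ^ (k + i + 1))‖ ≤
      ‖x‖ ^ n * B := fun k n => by
    rw [norm_mul, norm_pow]
    refine mul_le_mul (pow_le_pow_of_le_one (norm_nonneg _) hx.le (by nlinarith))
      (norm_prod_one_sub_pow_le hx k n) (norm_nonneg _) (by positivity)
  have h1 : Summable fun k : ℕ => (-1 : ℂ) ^ k * x ^ pentagonal (-k) :=
    Summable.of_norm_bounded hgeo fun k => by
      rw [norm_mul, norm_pow, norm_neg, norm_one, one_pow, one_mul, norm_pow]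
      exact pow_le_pow_of_le_one (norm_nonneg _) hx.le (le_pentagonal_neg k)
  have h2 : Summable fun k : ℕ => (-1 : ℂ) ^ k * x ^ pentagonal (k + 1) :=
    Summable.of_norm_bounded hgeo fun k => by
      rw [norm_mul, norm_pow, norm_neg, norm_one, one_pow, one_mul, norm_pow]
      exact pow_le_pow_of_le_one (norm_nonneg _) hx.le (le_pentagonal_add_one k)
  have h3 : ∀ k : ℕ, (-1 : ℂ) ^ k * (x ^ pentagonal (-k) - x ^ pentagonal (k + 1)) =
      (-1 : ℂ) ^ k * x ^ pentagonal (-k) - (-1 : ℂ) ^ k * x ^ pentagonal (k + 1) :=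
    fun k => mul_sub _ _ _
  have hmul : ∀ k : ℕ, Multipliable fun n : ℕ => 1 - x ^ (n + k + 1) := fun k => by
    simp_rw [sub_eq_add_neg]
    refine multipliable_one_add_of_summable (Summable.of_nonneg_of_le (fun _ => norm_nonneg _)
      (fun n => ?_) hgeo)
    rw [norm_neg, norm_pow]
    exact pow_le_pow_of_le_one (norm_nonneg _) hx.le (by omega)
  have key := Pentagonal.tprod_one_sub_pow (tendsto_pow_atTop_nhds_zero_of_norm_lt_one hx)
    (fun k => Summable.of_norm_bounded (hgeo.mul_right B) (hterm k)) hmul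
    (by simp_rw [h3]; exact h1.sub h2) ?_
  · rw [key]
    simp_rw [h3]
    rw [h1.tsum_sub h2, sub_eq_add_neg, ← tsum_neg]
    refine HasSum.of_nat_of_neg_add_one (by simpa using h1.hasSum) ?_
    refine h2.neg.hasSum.congr_fun fun k => ?_
    rw [neg_neg, zpow_neg, ← inv_zpow, inv_neg, inv_one, zpow_add₀ (by simp)]
    simp
  · refine squeeze_zero_norm (a := fun k => ‖x‖ ^ k * (∑' n, ‖x‖ ^ n * B)) (fun k => ?_) ?_
    · rw [norm_mul, norm_mul, norm_pow, norm_neg, norm_one, one_pow, one_mul, norm_pow]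
      refine mul_le_mul (pow_le_pow_of_le_one (norm_nonneg _) hx.le ?_)
        (tsum_of_norm_bounded (hgeo.mul_right B).hasSum (hterm k)) (norm_nonneg _) (by positivity)
      rw [Nat.le_div_iff_mul_le (by norm_num)]
      nlinarith
    · have := (tendsto_pow_atTop_nhds_zero_of_lt_one (norm_nonneg x) hx).mul_const
        (∑' n, ‖x‖ ^ n * B)
      rwa [zero_mul] at this

/-- The function on integers that is `1` on `± 1` and `-1` on `± 5` modulo `12`, and `0`
elsewhere, that is the even Dirichlet character `(12 / ·)`, split into the parts supported on
`1` and on `-1` modulo `6`. -/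
def charTwelve (N : ℤ) : ℂ :=
  (residueInd 12 1 N - residueInd 12 7 N) + (residueInd 12 (-1) N - residueInd 12 (-7) N)

lemma residueInd_six_mul_add_one (k : ℤ) :
    residueInd 12 1 (6 * k + 1) - residueInd 12 7 (6 * k + 1) = (-1 : ℂ) ^ k := by
  obtain ⟨s, rfl | rfl⟩ := Int.even_or_odd' k
  · rw [residueInd_eq_one (by omega), residueInd_eq_zero (by omega), zpow_mul]
    simp
  · rw [residueInd_eq_zero (by omega), residueInd_eq_one (by omega), zpow_add₀ (by simp), zpow_mul]
    simp

lemma expPow_six_mul_add_one (τ : ℍ) (k : ℤ) :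
    expPow τ (1 / 24 * ((6 * k + 1 : ℤ) : ℝ) ^ 2) =
      expPow τ (1 / 24) * expPow τ 1 ^ pentagonal (-k) := by
  rw [← expPow_nat, ← expPow_add]
  congr 1
  have h : (2 : ℝ) * (pentagonal (-k) : ℝ) = k * (3 * k + 1) := by
    exact_mod_cast two_mul_natCast_pentagonal_neg k
  push_cast
  linear_combination (-1 / 2 : ℝ) * h

lemma norm_expPow_one_lt (τ : ℍ) : ‖expPow τ 1‖ < 1 := by
  rw [norm_expPow, Real.exp_lt_one_iff]
  have h : 0 < Real.pi * (τ : ℂ).im := mul_pos Real.pi_pos τ.im_pos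
  linarith

lemma eta_eq (τ : ℍ) : eta τ = expPow τ (1 / 24) * ∏' n : ℕ, (1 - expPow τ 1 ^ (n + 1)) := by
  have h1 : Function.Periodic.qParam 24 (τ : ℂ) = expPow τ (1 / 24) := by
    rw [Function.Periodic.qParam, expPow]
    congr 1
    push_cast
    ring
  have h2 : Function.Periodic.qParam 1 (τ : ℂ) = expPow τ 1 := by
    rw [Function.Periodic.qParam, expPow]
    congr 1
    push_cast
    ring
  rw [eta, ModularForm.eta, h1]
  simp only [ModularForm.eta_q, h2]

/-- At `z = 0` the quintuple product series reduces to the pentagonal series, once for each of the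
two classes `± 1` modulo `6`. -/
lemma wsum_charTwelve_zero (τ : ℍ) : wsum charTwelve (1 / 24) τ 0 = 2 * eta τ := by
  -- The part of the series over `N = 6 k + 1`, whose exponents are
  -- `N ^ 2 / 24 = 1 / 24 + k (3 k + 1) / 2`.
  set g : ℤ → ℂ := fun N => (residueInd 12 1 N - residueInd 12 7 N) *
    (expPow τ (1 / 24 * (N : ℝ) ^ 2) * expPow 0 ((N : ℝ) / 2)) with hg
  have hinj : Function.Injective fun k : ℤ => 6 * k + 1 := fun a b h => by
    simp only at h
    omega
  have hpent := (hasSum_pentagonal (norm_expPow_one_lt τ)).mul_left (expPow τ (1 / 24))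
  rw [← eta_eq] at hpent
  have hsum : HasSum g (eta τ) := by
    rw [← hinj.hasSum_iff]
    · refine hpent.congr_fun fun k => ?_
      simp only [Function.comp, hg]
      rw [residueInd_six_mul_add_one, expPow_six_mul_add_one, expPow_zero_left]
      ring
    · intro N hN
      have : N % 6 ≠ 1 := fun h => hN ⟨N / 6, by simp only; omega⟩
      simp only [hg]
      rw [residueInd_eq_zero (by omega), residueInd_eq_zero (by omega)]
      ring
  have h2 := hsum.add ((Equiv.neg ℤ).hasSum_iff.mpr hsum)
  rw [wsum, two_mul, ← h2.tsum_eq]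
  refine tsum_congr fun N => ?_
  simp only [Function.comp, hg, Equiv.neg_apply, charTwelve, residueInd_neg, expPow_zero_left]
  push_cast
  rw [neg_sq]
  ring


/-! ### The addition formula for the genus-one theta functions -/

lemma exp_pi_mul (l b : ℤ) :
    Complex.exp (Complex.I * Real.pi * (l : ℂ) * (b : ℂ)) = (-1 : ℂ) ^ (l * b) := by
  rw [← Complex.exp_pi_mul_I, ← Complex.exp_int_mul]
  congr 1
  push_cast
  ring

lemma summable_norm_thetaChar (a b : ℤ) (τ : ℍ) (z : ℂ) :
    Summable fun l : ℤ => ‖expPow τ (((l : ℝ) + (a : ℝ) / 2) ^ 2 / 2) *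
      expPow z ((l : ℝ) + (a : ℝ) / 2) * Complex.exp (Complex.I * Real.pi * (l : ℂ) * (b : ℂ))‖ := by
  refine (summable_norm_expPow_mul (α := 1 / 2) (by norm_num) (a / 2) ((a : ℝ) ^ 2 / 8) 1 (a / 2)
    τ z).congr fun l => ?_
  rw [exp_pi_mul, norm_mul _ ((-1 : ℂ) ^ _), norm_neg_one_zpow, mul_one]
  ring_nf

/-- The general term of the series `θ_{1,n}`. -/
def thetaOneTerm (n : ℤ) (τ : ℍ) (z : ℂ) (m : ℤ) : ℂ :=
  expPow τ (((m : ℝ) + (n : ℝ) / 2) ^ 2) * expPow z ((m : ℝ) + (n : ℝ) / 2)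

lemma theta_one_eq_tsum (n : ℤ) (τ : ℍ) (z : ℂ) :
    theta 1 n τ z = ∑' m : ℤ, thetaOneTerm n τ z m := by
  rw [theta]
  refine tsum_congr fun m => ?_
  simp [thetaOneTerm]

lemma summable_norm_thetaOneTerm (n : ℤ) (τ : ℍ) (z : ℂ) :
    Summable fun m : ℤ => ‖thetaOneTerm n τ z m‖ := by
  refine (summable_norm_expPow_mul (α := 1) (by norm_num) n ((n : ℝ) ^ 2 / 4) 1 (n / 2)
    τ z).congr fun m => ?_
  rw [thetaOneTerm]
  ring_nf

lemma hasSum_theta_one_mul (a b : ℤ) (τ : ℍ) (x y : ℂ) :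
    HasSum (fun p : ℤ × ℤ => thetaOneTerm a τ x p.1 * thetaOneTerm b τ y p.2)
      (theta 1 a τ x * theta 1 b τ y) := by
  have h1 := summable_norm_thetaOneTerm a τ x
  have h2 := summable_norm_thetaOneTerm b τ y
  rw [theta_one_eq_tsum, theta_one_eq_tsum, tsum_mul_tsum_of_summable_norm h1 h2]
  exact (Summable.mul_norm h1 h2).of_norm.hasSum

/-- Pairs of integers, split according to the parity of their sum. -/
def parityEquiv : (ℤ × ℤ) ⊕ (ℤ × ℤ) ≃ ℤ × ℤ :=
  Equiv.ofBijective
    (Sum.elim (fun p => (p.1 + p.2, p.1 - p.2)) fun p => (p.1 + p.2 + 1, p.1 - p.2)) (by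
      constructor
      · rintro (⟨a, b⟩ | ⟨a, b⟩) (⟨c, d⟩ | ⟨c, d⟩) h <;>
          simp only [Sum.elim_inl, Sum.elim_inr, Prod.mk.injEq, Sum.inl.injEq, Sum.inr.injEq,
            reduceCtorEq] at h ⊢ <;> omega
      · rintro ⟨c, d⟩
        rcases Int.emod_two_eq_zero_or_one (c + d) with h | h
        · exact ⟨Sum.inl ((c + d) / 2, (c - d) / 2), by
            simp only [Sum.elim_inl, Prod.mk.injEq]; omega⟩
        · exact ⟨Sum.inr ((c + d) / 2, (c - d) / 2), by
            simp only [Sum.elim_inr, Prod.mk.injEq]; omega⟩)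

lemma parityEquiv_inl (a b : ℤ) : parityEquiv (Sum.inl (a, b)) = (a + b, a - b) := rfl

lemma parityEquiv_inr (a b : ℤ) : parityEquiv (Sum.inr (a, b)) = (a + b + 1, a - b) := rfl

/-- The addition formula: with `A = l + a / 2` and `B = l' + a / 2` one has
`(A ^ 2 + B ^ 2) / 2 = ((A + B) / 2) ^ 2 + ((A - B) / 2) ^ 2`, and the pairs `(l, l')` are split
according to the parity of `l + l'`. -/
theorem thetaChar_mul_thetaChar (a b : ℤ) (τ : ℍ) (x y : ℂ) :
    thetaChar a b τ x * thetaChar a b τ y =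
      theta 1 a τ (x + y) * theta 1 0 τ (x - y) +
        (-1 : ℂ) ^ b * (theta 1 (a + 1) τ (x + y) * theta 1 1 τ (x - y)) := by
  have h1 := summable_norm_thetaChar a b τ x
  have h2 := summable_norm_thetaChar a b τ y
  have h3 := (Summable.mul_norm h1 h2).of_norm.hasSum
  rw [← tsum_mul_tsum_of_summable_norm h1 h2, ← parityEquiv.hasSum_iff] at h3
  refine h3.unique (HasSum.sum ?_ ?_)
  · refine (hasSum_theta_one_mul a 0 τ (x + y) (x - y)).congr_fun fun p => ?_
    obtain ⟨M, M'⟩ := p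
    simp only [Function.comp, parityEquiv_inl, thetaOneTerm, exp_pi_mul]
    have hs : (-1 : ℂ) ^ ((M + M') * b) * (-1 : ℂ) ^ ((M - M') * b) = 1 := by
      rw [← zpow_add₀ (by simp), show (M + M') * b + (M - M') * b = 2 * (M * b) by ring, zpow_mul]
      simp
    have hq : expPow τ ((((M + M' : ℤ) : ℝ) + (a : ℝ) / 2) ^ 2 / 2) *
        expPow τ ((((M - M' : ℤ) : ℝ) + (a : ℝ) / 2) ^ 2 / 2) =
        expPow τ (((M : ℝ) + (a : ℝ) / 2) ^ 2) * expPow τ (((M' : ℝ) + ((0 : ℤ) : ℝ) / 2) ^ 2) := by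
      rw [← expPow_add, ← expPow_add]
      congr 1
      push_cast
      ring
    have hz : expPow x (((M + M' : ℤ) : ℝ) + (a : ℝ) / 2) *
        expPow y (((M - M' : ℤ) : ℝ) + (a : ℝ) / 2) =
        expPow (x + y) ((M : ℝ) + (a : ℝ) / 2) * expPow (x - y) ((M' : ℝ) + ((0 : ℤ) : ℝ) / 2) := by
      rw [sub_eq_add_neg x y, expPow_add_left x y, expPow_add_left x (-y), expPow_neg_left,
        mul_mul_mul_comm, ← expPow_add, ← expPow_add]
      congr 2 <;> push_cast <;> ring
    rw [mul_mul_mul_comm, hs, mul_one, mul_mul_mul_comm, hq, hz]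
    ring
  · refine ((hasSum_theta_one_mul (a + 1) 1 τ (x + y) (x - y)).mul_left _).congr_fun fun p => ?_
    obtain ⟨M, M'⟩ := p
    simp only [Function.comp, parityEquiv_inr, thetaOneTerm, exp_pi_mul]
    have hs : (-1 : ℂ) ^ ((M + M' + 1) * b) * (-1 : ℂ) ^ ((M - M') * b) = (-1 : ℂ) ^ b := by
      rw [← zpow_add₀ (by simp), show (M + M' + 1) * b + (M - M') * b = 2 * (M * b) + b by ring,
        zpow_add₀ (by simp), zpow_mul]
      simp
    have hq : expPow τ ((((M + M' + 1 : ℤ) : ℝ) + (a : ℝ) / 2) ^ 2 / 2) *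
        expPow τ ((((M - M' : ℤ) : ℝ) + (a : ℝ) / 2) ^ 2 / 2) =
        expPow τ (((M : ℝ) + ((a + 1 : ℤ) : ℝ) / 2) ^ 2) *
          expPow τ (((M' : ℝ) + ((1 : ℤ) : ℝ) / 2) ^ 2) := by
      rw [← expPow_add, ← expPow_add]
      congr 1
      push_cast
      ring
    have hz : expPow x (((M + M' + 1 : ℤ) : ℝ) + (a : ℝ) / 2) *
        expPow y (((M - M' : ℤ) : ℝ) + (a : ℝ) / 2) =
        expPow (x + y) ((M : ℝ) + ((a + 1 : ℤ) : ℝ) / 2) *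
          expPow (x - y) ((M' : ℝ) + ((1 : ℤ) : ℝ) / 2) := by
      rw [sub_eq_add_neg x y, expPow_add_left x y, expPow_add_left x (-y), expPow_neg_left,
        mul_mul_mul_comm, ← expPow_add, ← expPow_add]
      congr 2 <;> push_cast <;> ring
    rw [mul_mul_mul_comm, hs, mul_mul_mul_comm, hq, hz]
    ring

lemma theta_one_two (τ : ℍ) (z : ℂ) : theta 1 2 τ z = theta 1 0 τ z := by
  rw [theta_one_eq_tsum, theta_one_eq_tsum, ← (Equiv.addRight (1 : ℤ)).tsum_eq (thetaOneTerm 0 τ z)]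
  refine tsum_congr fun m => ?_
  simp [thetaOneTerm]

lemma theta_two_mul (τ : ℍ) (x y : ℂ) : thetaChar 1 0 τ x * thetaChar 1 0 τ y =
    theta 1 1 τ (x + y) * theta 1 0 τ (x - y) + theta 1 0 τ (x + y) * theta 1 1 τ (x - y) := by
  have h := thetaChar_mul_thetaChar 1 0 τ x y
  rw [show (1 : ℤ) + 1 = 2 by norm_num, theta_one_two] at h
  simpa using h

lemma theta_three_mul (τ : ℍ) (x y : ℂ) : thetaChar 0 0 τ x * thetaChar 0 0 τ y =
    theta 1 0 τ (x + y) * theta 1 0 τ (x - y) + theta 1 1 τ (x + y) * theta 1 1 τ (x - y) := by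
  simpa using thetaChar_mul_thetaChar 0 0 τ x y

lemma theta_four_mul (τ : ℍ) (x y : ℂ) : thetaChar 0 1 τ x * thetaChar 0 1 τ y =
    theta 1 0 τ (x + y) * theta 1 0 τ (x - y) - theta 1 1 τ (x + y) * theta 1 1 τ (x - y) := by
  simpa [sub_eq_add_neg] using thetaChar_mul_thetaChar 0 1 τ x y

lemma theta_four_eq_shift (τ : ℍ) (z : ℂ) :
    thetaChar 0 1 τ z = thetaChar 0 0 τ (z + 1 / 2) := by
  rw [thetaChar, thetaChar]
  refine tsum_congr fun l => ?_
  rw [expPow_add_left, exp_pi_mul, exp_pi_mul]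
  have h : expPow (1 / 2) ((l : ℝ) + ((0 : ℤ) : ℝ) / 2) = (-1 : ℂ) ^ (l * 1) := by
    rw [← exp_pi_mul, expPow]
    congr 1
    push_cast
    ring
  rw [h]
  simp
  ring

/-- The terms at `m` and `-1 - m` cancel. -/
lemma theta_one_one_neg_half (τ : ℍ) : theta 1 1 τ (-(1 / 2)) = 0 := by
  have h : theta 1 1 τ (-(1 / 2)) = -theta 1 1 τ (-(1 / 2)) := by
    conv_lhs => rw [theta_one_eq_tsum, ← (Equiv.subLeft (-1 : ℤ)).tsum_eq]
    rw [theta_one_eq_tsum, ← tsum_neg]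
    refine tsum_congr fun m => ?_
    simp only [Equiv.subLeft_apply, thetaOneTerm]
    have h1 : (((-1 - m : ℤ) : ℝ) + ((1 : ℤ) : ℝ) / 2) ^ 2 =
        ((m : ℝ) + ((1 : ℤ) : ℝ) / 2) ^ 2 := by
      push_cast
      ring
    have h2 : expPow (-(1 / 2)) (((-1 - m : ℤ) : ℝ) + ((1 : ℤ) : ℝ) / 2) =
        -expPow (-(1 / 2)) ((m : ℝ) + ((1 : ℤ) : ℝ) / 2) := by
      have h3 : (((-1 - m : ℤ) : ℝ) + ((1 : ℤ) : ℝ) / 2) =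
          ((m : ℝ) + ((1 : ℤ) : ℝ) / 2) + ((-(2 * m + 1) : ℤ) : ℝ) := by
        push_cast
        ring
      have h4 : expPow (-(1 / 2)) ((-(2 * m + 1) : ℤ) : ℝ) = (-1 : ℂ) ^ ((2 * m + 1) * 1) := by
        rw [← exp_pi_mul, expPow]
        congr 1
        push_cast
        ring
      rw [h3, expPow_add, h4, mul_one, zpow_add₀ (by simp), zpow_mul]
      simp
    rw [h1, h2]
    ring
  linear_combination h / 2

/-- A Landen transformation: the product `ϑ₃ ϑ₄` is a single theta series in `2 z`. -/
lemma theta_three_mul_theta_four (τ : ℍ) (z : ℂ) :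
    thetaChar 0 0 τ z * thetaChar 0 1 τ z =
      theta 1 0 τ (2 * z + 1 / 2) * theta 1 0 τ (-(1 / 2)) := by
  rw [theta_four_eq_shift, theta_three_mul, show z - (z + 1 / 2) = -(1 / 2) by ring,
    theta_one_one_neg_half, mul_zero, add_zero, show z + (z + 1 / 2) = 2 * z + 1 / 2 by ring]

/-! ### The quintuple product -/

lemma theta_two_eq_wsum (τ : ℍ) (z : ℂ) :
    thetaChar 1 0 τ z = wsum (residueInd 2 1) (1 / 8) τ z := by
  have h := tsum_progression (p := 2) (by norm_num) 1 fun N : ℤ =>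
    expPow τ (1 / 8 * (N : ℝ) ^ 2) * expPow z ((N : ℝ) / 2)
  rw [thetaChar, wsum]
  simp only [residueInd]
  rw [← h]
  refine tsum_congr fun l => ?_
  rw [exp_pi_mul, mul_zero, zpow_zero, mul_one]
  congr 2
  · push_cast
    ring
  · push_cast
    ring

lemma theta_three_eq_wsum (τ : ℍ) (z : ℂ) :
    thetaChar 0 0 τ z = wsum (residueInd 2 0) (1 / 8) τ z := by
  have h := tsum_progression (p := 2) (by norm_num) 0 fun N : ℤ =>
    expPow τ (1 / 8 * (N : ℝ) ^ 2) * expPow z ((N : ℝ) / 2)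
  rw [thetaChar, wsum]
  simp only [residueInd]
  rw [← h]
  refine tsum_congr fun l => ?_
  rw [exp_pi_mul, mul_zero, zpow_zero, mul_one]
  congr 2
  · push_cast
    ring
  · push_cast
    ring

/-- The function supported on multiples of `4` with the value `(-1) ^ m` at `4 m`. -/
def signEight (N : ℤ) : ℂ := residueInd 8 0 N - residueInd 8 4 N

lemma norm_signEight_le (N : ℤ) : ‖signEight N‖ ≤ 2 := by
  have h := norm_sub_le (residueInd 8 0 N) (residueInd 8 4 N)
  have h1 := norm_residueInd_le 8 0 N
  have h2 := norm_residueInd_le 8 4 N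
  rw [signEight]
  linarith

lemma signEight_four_mul (m : ℤ) : signEight (4 * m) = (-1 : ℂ) ^ m := by
  rw [signEight]
  obtain ⟨s, rfl | rfl⟩ := Int.even_or_odd' m
  · rw [residueInd_eq_one (by omega), residueInd_eq_zero (by omega), zpow_mul]
    simp
  · rw [residueInd_eq_zero (by omega), residueInd_eq_one (by omega), zpow_add₀ (by simp), zpow_mul]
    simp

lemma signEight_eq_zero {N : ℤ} (h : N % 4 ≠ 0) : signEight N = 0 := by
  rw [signEight, residueInd_eq_zero (by omega), residueInd_eq_zero (by omega), sub_zero]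

lemma signEight_add_four (N : ℤ) : signEight (N + 4) = -signEight N := by
  by_cases h : N % 4 = 0
  · obtain ⟨t, rfl⟩ : ∃ t, N = 4 * t := ⟨N / 4, by omega⟩
    rw [show 4 * t + 4 = 4 * (t + 1) by ring, signEight_four_mul, signEight_four_mul,
      zpow_add₀ (by simp)]
    simp
  · rw [signEight_eq_zero h, signEight_eq_zero (by omega), neg_zero]

lemma signEight_neg (N : ℤ) : signEight (-N) = signEight N := by
  by_cases h : N % 4 = 0
  · obtain ⟨t, rfl⟩ : ∃ t, N = 4 * t := ⟨N / 4, by omega⟩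
    rw [show -(4 * t) = 4 * -t by ring, signEight_four_mul, signEight_four_mul, zpow_neg,
      ← inv_zpow, inv_neg, inv_one]
  · rw [signEight_eq_zero h, signEight_eq_zero (by omega)]

lemma theta_one_zero_eq_wsum (τ : ℍ) (z : ℂ) :
    theta 1 0 τ (2 * z + 1 / 2) = wsum signEight (1 / 16) τ z := by
  -- The shift of `z` by `1 / 2` produces the sign `(-1) ^ m` at `N = 4 m`.
  have hinj : Function.Injective fun m : ℤ => 4 * m := fun a b h => by
    simp only at h
    omega
  rw [theta_one_eq_tsum, wsum, ← hinj.tsum_eq (f := fun N : ℤ =>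
    signEight N * (expPow τ (1 / 16 * (N : ℝ) ^ 2) * expPow z ((N : ℝ) / 2)))]
  · refine tsum_congr fun m => ?_
    rw [thetaOneTerm, signEight_four_mul, expPow_add_left]
    have h1 : expPow (1 / 2) ((m : ℝ) + ((0 : ℤ) : ℝ) / 2) = (-1 : ℂ) ^ (m * 1) := by
      rw [← exp_pi_mul, expPow]
      congr 1
      push_cast
      ring
    have h2 : expPow (2 * z) ((m : ℝ) + ((0 : ℤ) : ℝ) / 2) =
        expPow z (((4 * m : ℤ) : ℝ) / 2) := by
      rw [expPow, expPow]
      congr 1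
      push_cast
      ring
    have h3 : ((m : ℝ) + ((0 : ℤ) : ℝ) / 2) ^ 2 = 1 / 16 * ((4 * m : ℤ) : ℝ) ^ 2 := by
      push_cast
      ring
    rw [h1, h2, h3, mul_one]
    ring
  · intro N hN
    by_contra h
    refine hN ?_
    simp only
    rw [signEight_eq_zero fun h4 => h ⟨N / 4, by simp only; omega⟩, zero_mul]

/-- The coefficient of `q ^ (N ^ 2 / 24) r ^ (N / 2)` in `ϑ₂(τ, z) θ_{1,0}(τ, 2 z + 1 / 2)`. -/
def quintupleCoeff (τ : ℍ) (N : ℤ) : ℂ :=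
  ∑' m : ℤ, residueInd 2 1 m * signEight (N - m) *
    expPow τ ((1 / 8 + 1 / 16) * ((m : ℝ) - 1 / 16 / (1 / 8 + 1 / 16) * N) ^ 2)

lemma quintupleCoeff_neg (τ : ℍ) (N : ℤ) : quintupleCoeff τ (-N) = quintupleCoeff τ N := by
  rw [quintupleCoeff, quintupleCoeff, ← (Equiv.neg ℤ).tsum_eq]
  refine tsum_congr fun m => ?_
  simp only [Equiv.neg_apply]
  have h : residueInd 2 1 (-m) = residueInd 2 1 m := by
    by_cases h : m % 2 = 1
    · rw [residueInd_eq_one (by omega), residueInd_eq_one (by omega)]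
    · rw [residueInd_eq_zero (by omega), residueInd_eq_zero (by omega)]
  rw [h, show -N - -m = -(N - m) by ring, signEight_neg]
  push_cast
  ring_nf

lemma quintupleCoeff_add_six (τ : ℍ) (N : ℤ) :
    quintupleCoeff τ (N + 6) = -quintupleCoeff τ N := by
  rw [quintupleCoeff, quintupleCoeff, ← tsum_neg, ← (Equiv.addRight (2 : ℤ)).tsum_eq]
  refine tsum_congr fun m => ?_
  simp only [Equiv.coe_addRight]
  rw [residueInd_add_period, show N + 6 - (m + 2) = N - m + 4 by ring, signEight_add_four]
  push_cast
  ring_nf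

lemma quintupleCoeff_even (τ : ℍ) {N : ℤ} (hN : N % 2 = 0) : quintupleCoeff τ N = 0 := by
  rw [quintupleCoeff]
  refine (tsum_congr fun m => ?_).trans tsum_zero
  by_cases h : m % 2 = 1
  · rw [signEight_eq_zero (by omega), mul_zero, zero_mul]
  · rw [residueInd_eq_zero (by omega), zero_mul, zero_mul]

/-- Evenness and the antiperiod `6` leave one free coefficient; the class of `3` vanishes because
`3 = -3 + 6`. -/
lemma quintupleCoeff_eq (τ : ℍ) (N : ℤ) :
    quintupleCoeff τ N = quintupleCoeff τ 1 * charTwelve N := by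
  have hper : Function.Periodic (quintupleCoeff τ) 12 := fun N => by
    rw [show N + 12 = N + 6 + 6 by ring, quintupleCoeff_add_six, quintupleCoeff_add_six, neg_neg]
  have h3 : quintupleCoeff τ 3 = 0 := by
    have h := quintupleCoeff_add_six τ (-3)
    rw [quintupleCoeff_neg, show (-3 : ℤ) + 6 = 3 by norm_num] at h
    linear_combination h / 2
  have h5 : quintupleCoeff τ 5 = -quintupleCoeff τ 1 := by
    have h := quintupleCoeff_add_six τ (-1)
    rwa [quintupleCoeff_neg, show (-1 : ℤ) + 6 = 5 by norm_num] at h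
  have h7 : quintupleCoeff τ 7 = -quintupleCoeff τ 1 := quintupleCoeff_add_six τ 1
  have h9 : quintupleCoeff τ 9 = 0 := by
    have h := quintupleCoeff_add_six τ 3
    rwa [h3, neg_zero] at h
  have h11 : quintupleCoeff τ 11 = quintupleCoeff τ 1 := by
    have h := quintupleCoeff_add_six τ 5
    rwa [h5, neg_neg] at h
  have hmod : quintupleCoeff τ N = quintupleCoeff τ (N % 12) := by
    conv_lhs => rw [← Int.emod_add_mul_ediv N 12, mul_comm]
    exact hper.int_mul _ _
  rw [hmod, charTwelve]
  have hr0 := Int.emod_nonneg N (show (12 : ℤ) ≠ 0 by norm_num)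
  have hr1 := Int.emod_lt_of_pos N (show (0 : ℤ) < 12 by norm_num)
  by_cases heven : N % 2 = 0
  · rw [quintupleCoeff_even τ (by omega), residueInd_eq_zero (by omega),
      residueInd_eq_zero (by omega), residueInd_eq_zero (by omega), residueInd_eq_zero (by omega)]
    simp
  · have hcases : N % 12 = 1 ∨ N % 12 = 3 ∨ N % 12 = 5 ∨ N % 12 = 7 ∨ N % 12 = 9 ∨
        N % 12 = 11 := by omega
    rcases hcases with h | h | h | h | h | h <;> rw [h]
    · rw [residueInd_eq_one (by omega), residueInd_eq_zero (by omega),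
        residueInd_eq_zero (by omega), residueInd_eq_zero (by omega)]
      simp
    · rw [h3, residueInd_eq_zero (by omega), residueInd_eq_zero (by omega),
        residueInd_eq_zero (by omega), residueInd_eq_zero (by omega)]
      simp
    · rw [h5, residueInd_eq_zero (by omega), residueInd_eq_zero (by omega),
        residueInd_eq_zero (by omega), residueInd_eq_one (by omega)]
      simp
    · rw [h7, residueInd_eq_zero (by omega), residueInd_eq_one (by omega),
        residueInd_eq_zero (by omega), residueInd_eq_zero (by omega)]
      simp
    · rw [h9, residueInd_eq_zero (by omega), residueInd_eq_zero (by omega),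
        residueInd_eq_zero (by omega), residueInd_eq_zero (by omega)]
      simp
    · rw [h11, residueInd_eq_zero (by omega), residueInd_eq_zero (by omega),
        residueInd_eq_one (by omega), residueInd_eq_zero (by omega)]
      simp

/-- The quintuple product identity, up to a factor that depends on `τ` only. -/
lemma theta_product_eq (τ : ℍ) (z : ℂ) :
    thetaChar 1 0 τ z * thetaChar 0 0 τ z * thetaChar 0 1 τ z =
      theta 1 0 τ (-(1 / 2)) * quintupleCoeff τ 1 * wsum charTwelve (1 / 24) τ z := by
  have h := (wsum_mul_wsum (norm_residueInd_le 2 1) norm_signEight_le (α := 1 / 8) (β := 1 / 16)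
    (by norm_num) (by norm_num) τ z).tsum_eq
  rw [mul_assoc (thetaChar 1 0 τ z), theta_three_mul_theta_four, theta_one_zero_eq_wsum,
    theta_two_eq_wsum, mul_comm (wsum signEight _ _ _), mul_left_comm, ← h, mul_assoc]
  congr 1
  rw [← wsum_const_mul, wsum]
  refine tsum_congr fun N => ?_
  rw [← quintupleCoeff_eq, quintupleCoeff]
  norm_num

lemma differentiable_theta_two (τ : ℍ) : Differentiable ℂ (thetaChar 1 0 τ) := by
  rw [show thetaChar 1 0 τ = wsum (residueInd 2 1) (1 / 8) τ from funext (theta_two_eq_wsum τ)]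
  exact differentiable_wsum (norm_residueInd_le _ _) (by norm_num) τ

lemma differentiable_theta_three (τ : ℍ) : Differentiable ℂ (thetaChar 0 0 τ) := by
  rw [show thetaChar 0 0 τ = wsum (residueInd 2 0) (1 / 8) τ from funext (theta_three_eq_wsum τ)]
  exact differentiable_wsum (norm_residueInd_le _ _) (by norm_num) τ

lemma differentiable_theta_four (τ : ℍ) : Differentiable ℂ (thetaChar 0 1 τ) := by
  rw [show thetaChar 0 1 τ = fun z => thetaChar 0 0 τ (z + 1 / 2) from
    funext (theta_four_eq_shift τ)]
  exact (differentiable_theta_three τ).comp (by fun_prop)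

/-- The factor in the quintuple product identity is nonzero, since `ϑ₂ ϑ₃ ϑ₄` does not vanish
identically in `z`. -/
lemma quintuple_factor_ne_zero (τ : ℍ) :
    theta 1 0 τ (-(1 / 2)) * quintupleCoeff τ 1 ≠ 0 := by
  intro h0
  have hprod : ∀ z, thetaChar 1 0 τ z * thetaChar 0 0 τ z * thetaChar 0 1 τ z = 0 := fun z => by
    rw [theta_product_eq, h0, zero_mul]
  have h2 : ¬ ∀ z, thetaChar 1 0 τ z = 0 := fun h => by
    have := wsum_eq_zero (norm_residueInd_le 2 1) (α := 1 / 8) (by norm_num)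
      (fun z => (theta_two_eq_wsum τ z).symm.trans (h z)) 1
    rw [residueInd_eq_one rfl] at this
    exact one_ne_zero this
  have h3 : ¬ ∀ z, thetaChar 0 0 τ z = 0 := fun h => by
    have := wsum_eq_zero (norm_residueInd_le 2 0) (α := 1 / 8) (by norm_num)
      (fun z => (theta_three_eq_wsum τ z).symm.trans (h z)) 0
    rw [residueInd_eq_one rfl] at this
    exact one_ne_zero this
  have h4 : ¬ ∀ z, thetaChar 0 1 τ z = 0 := fun h => h3 fun z => by
    have := h (z - 1 / 2)
    rwa [theta_four_eq_shift, sub_add_cancel] at this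
  rcases eq_zero_or_eq_zero_of_entire
    ((differentiable_theta_two τ).mul (differentiable_theta_three τ))
    (differentiable_theta_four τ) hprod with h | h
  · exact (eq_zero_or_eq_zero_of_entire (differentiable_theta_two τ)
      (differentiable_theta_three τ) h).elim h2 h3
  · exact h4 h

/-- The theta constants `ϑ₂, ϑ₃, ϑ₄` do not vanish: their product is a nonzero multiple of `η`. -/
lemma theta_constants_ne_zero (τ : ℍ) :
    thetaChar 1 0 τ 0 * thetaChar 0 0 τ 0 * thetaChar 0 1 τ 0 ≠ 0 := by
  rw [theta_product_eq, wsum_charTwelve_zero]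
  exact mul_ne_zero (quintuple_factor_ne_zero τ) (mul_ne_zero two_ne_zero (eta_ne_zero τ))

/-- The quintuple product identity `2 η f₂ f₃ f₄ = ∑ N, (12 / N) q ^ (N ^ 2 / 24) r ^ (N / 2)`. -/
theorem two_eta_mul_f2_f3_f4 (τ : ℍ) (z : ℂ) :
    2 * eta τ * (f2 τ z * f3 τ z * f4 τ z) = wsum charTwelve (1 / 24) τ z := by
  have h0 := theta_constants_ne_zero τ
  have hz := theta_product_eq τ z
  have hzero := theta_product_eq τ 0
  rw [wsum_charTwelve_zero] at hzero
  have e : f2 τ z * f3 τ z * f4 τ z =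
      thetaChar 1 0 τ z * thetaChar 0 0 τ z * thetaChar 0 1 τ z /
      (thetaChar 1 0 τ 0 * thetaChar 0 0 τ 0 * thetaChar 0 1 τ 0) := by
    rw [f2, f3, f4, div_mul_div_comm, div_mul_div_comm]
  rw [e, mul_div_assoc', div_eq_iff h0, hz, hzero]
  ring

/-! ### Duplication formulas and the umbral Jacobi form -/

/-- The duplication formulas for `f₂, f₃, f₄`, as polynomial identities in their squares. -/
lemma duplication (τ : ℍ) (z : ℂ) :
    f2 τ (2 * z) = f2 τ z ^ 2 * f3 τ z ^ 2 + f4 τ z ^ 2 * f2 τ z ^ 2 - f3 τ z ^ 2 * f4 τ z ^ 2 ∧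
    f3 τ (2 * z) = f2 τ z ^ 2 * f3 τ z ^ 2 + f3 τ z ^ 2 * f4 τ z ^ 2 - f4 τ z ^ 2 * f2 τ z ^ 2 ∧
    f4 τ (2 * z) = f3 τ z ^ 2 * f4 τ z ^ 2 + f4 τ z ^ 2 * f2 τ z ^ 2 - f2 τ z ^ 2 * f3 τ z ^ 2 := by
  have h0 := theta_constants_ne_zero τ
  have n2 : thetaChar 1 0 τ 0 ≠ 0 := left_ne_zero_of_mul (left_ne_zero_of_mul h0)
  have n3 : thetaChar 0 0 τ 0 ≠ 0 := right_ne_zero_of_mul (left_ne_zero_of_mul h0)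
  have n4 : thetaChar 0 1 τ 0 ≠ 0 := right_ne_zero_of_mul h0
  have c2 := theta_two_mul τ 0 0
  have c3 := theta_three_mul τ 0 0
  have c4 := theta_four_mul τ 0 0
  have s2 := theta_two_mul τ z z
  have s3 := theta_three_mul τ z z
  have s4 := theta_four_mul τ z z
  have d2 := theta_two_mul τ (2 * z) 0
  have d3 := theta_three_mul τ (2 * z) 0
  have d4 := theta_four_mul τ (2 * z) 0
  simp only [add_zero, sub_zero, sub_self, ← two_mul, mul_zero] at c2 c3 c4 s2 s3 s4 d2 d3 d4
  set A := theta 1 0 τ (2 * z)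
  set B := theta 1 1 τ (2 * z)
  set a := theta 1 0 τ 0
  set b := theta 1 1 τ 0
  have m2 : 2 * (a * b) ≠ 0 := by
    have := mul_ne_zero n2 n2
    rwa [c2, show b * a + a * b = 2 * (a * b) by ring] at this
  have m3 : a * a + b * b ≠ 0 := c3 ▸ mul_ne_zero n3 n3
  have m4 : a * a - b * b ≠ 0 := c4 ▸ mul_ne_zero n4 n4
  have ha : a ≠ 0 := fun h => m2 (by rw [h]; ring)
  have hb : b ≠ 0 := fun h => m2 (by rw [h]; ring)
  have x2 : f2 τ z ^ 2 = (B * a + A * b) / (2 * (a * b)) := by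
    rw [f2, div_pow, sq, sq, s2, c2]
    ring
  have x3 : f3 τ z ^ 2 = (A * a + B * b) / (a * a + b * b) := by
    rw [f3, div_pow, sq, sq, s3, c3]
  have x4 : f4 τ z ^ 2 = (A * a - B * b) / (a * a - b * b) := by
    rw [f4, div_pow, sq, sq, s4, c4]
  have y2 : f2 τ (2 * z) = A * B / (a * b) := by
    rw [f2, ← mul_div_mul_right _ _ n2, d2, c2, div_eq_div_iff (by
      rw [show b * a + a * b = 2 * (a * b) by ring]; exact m2) (mul_ne_zero ha hb)]
    ring
  have y3 : f3 τ (2 * z) = (A * A + B * B) / (a * a + b * b) := by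
    rw [f3, ← mul_div_mul_right _ _ n3, d3, c3]
  have y4 : f4 τ (2 * z) = (A * A - B * B) / (a * a - b * b) := by
    rw [f4, ← mul_div_mul_right _ _ n4, d4, c4]
  rw [x2, x3, x4, y2, y3, y4]
  have m3' : a ^ 2 + b ^ 2 ≠ 0 := by rwa [sq, sq]
  have m4' : a ^ 2 - b ^ 2 ≠ 0 := by rwa [sq, sq]
  refine ⟨?_, ?_, ?_⟩ <;> field_simp <;> ring

/-- The umbral Jacobi form of lambency 7 is `ϑ₁(τ, 4 z) / ϑ₁(τ, 2 z)`, here in the form of the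
product `2 f₂ f₃ f₄` at `2 z`. -/
theorem psi6_eq (τ : ℍ) (z : ℂ) :
    psi6 τ z = 2 * (f2 τ (2 * z) * f3 τ (2 * z) * f4 τ (2 * z)) := by
  obtain ⟨h2, h3, h4⟩ := duplication τ z
  rw [h2, h3, h4, psi6, psi4, psi3, psi2, psi1]
  ring

lemma theta_twentyfour_eq_wsum (j : ℤ) (τ : ℍ) (z : ℂ) :
    theta 24 (2 * j) τ z = wsum (residueInd 24 j) (1 / 24) τ (2 * z) := by
  have h := tsum_progression (p := 24) (by norm_num) j fun N : ℤ =>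
    expPow τ (1 / 24 * (N : ℝ) ^ 2) * expPow (2 * z) ((N : ℝ) / 2)
  rw [theta, wsum]
  simp only [residueInd]
  rw [← h]
  refine tsum_congr fun m => ?_
  congr 1
  · congr 1
    push_cast
    ring
  · rw [expPow, expPow]
    congr 1
    push_cast
    ring

lemma thetaSym_twentyfour_eq_wsum (j : ℤ) (τ : ℍ) (z : ℂ) :
    thetaSym 24 (2 * j) τ z =
      wsum (fun N => residueInd 24 j N + residueInd 24 (-j) N) (1 / 24) τ (2 * z) := by
  rw [thetaSym, ← mul_neg, theta_twentyfour_eq_wsum, theta_twentyfour_eq_wsum,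
    wsum_add (norm_residueInd_le _ _) (norm_residueInd_le _ _) (by norm_num)]

lemma norm_residueInd_add_le (p c d N : ℤ) : ‖residueInd p c N + residueInd p d N‖ ≤ 2 := by
  have h := norm_add_le (residueInd p c N) (residueInd p d N)
  have h1 := norm_residueInd_le p c N
  have h2 := norm_residueInd_le p d N
  linarith

lemma residueInd_twelve (c N : ℤ) :
    residueInd 12 c N = residueInd 24 c N + residueInd 24 (c + 12) N := by
  by_cases h : N % 24 = c % 24
  · rw [residueInd_eq_one h, residueInd_eq_one (by omega), residueInd_eq_zero (by omega), add_zero]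
  · by_cases h' : N % 24 = (c + 12) % 24
    · rw [residueInd_eq_zero h, residueInd_eq_one h', residueInd_eq_one (by omega), zero_add]
    · rw [residueInd_eq_zero h, residueInd_eq_zero h', residueInd_eq_zero (by omega), zero_add]

lemma charTwelve_eq (N : ℤ) :
    charTwelve N = (residueInd 24 1 N + residueInd 24 (-1) N) +
      (residueInd 24 11 N + residueInd 24 (-11) N) -
      ((residueInd 24 5 N + residueInd 24 (-5) N) +
      (residueInd 24 7 N + residueInd 24 (-7) N)) := by
  have h1 : residueInd 24 13 N = residueInd 24 (-11) N := by
    rw [residueInd, residueInd]; rfl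
  have h2 : residueInd 24 19 N = residueInd 24 (-5) N := by
    rw [residueInd, residueInd]; rfl
  rw [charTwelve, residueInd_twelve, residueInd_twelve 7, residueInd_twelve (-1),
    residueInd_twelve (-7)]
  norm_num [h1, h2]
  ring

/-- The theta expansion of the umbral Jacobi form of lambency 7. -/
theorem eta_mul_psi6 (τ : ℍ) (z : ℂ) :
    eta τ * psi6 τ z = thetaSym 24 2 τ z + thetaSym 24 22 τ z
      - thetaSym 24 10 τ z - thetaSym 24 14 τ z := by
  have b := fun c d : ℤ => norm_residueInd_add_le 24 c d
  have b4 : ∀ c d c' d' N : ℤ, ‖(residueInd 24 c N + residueInd 24 d N) +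
      (residueInd 24 c' N + residueInd 24 d' N)‖ ≤ 4 := fun c d c' d' N => by
    have h := norm_add_le (residueInd 24 c N + residueInd 24 d N)
      (residueInd 24 c' N + residueInd 24 d' N)
    have h1 := b c d N
    have h2 := b c' d' N
    linarith
  have e1 := thetaSym_twentyfour_eq_wsum 1 τ z
  have e11 := thetaSym_twentyfour_eq_wsum 11 τ z
  have e5 := thetaSym_twentyfour_eq_wsum 5 τ z
  have e7 := thetaSym_twentyfour_eq_wsum 7 τ z
  norm_num only at e1 e11 e5 e7
  have h := two_eta_mul_f2_f3_f4 τ (2 * z)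
  rw [show charTwelve = _ from funext charTwelve_eq,
    wsum_sub (b4 _ _ _ _) (b4 _ _ _ _) (by norm_num),
    wsum_add (b _ _) (b _ _) (by norm_num), wsum_add (b _ _) (b _ _) (by norm_num)] at h
  rw [psi6_eq, e1, e11, e5, e7]
  linear_combination h


/-! ### The character decomposition of the umbral Jacobi form -/

lemma thetaSym_eq_sum_even {k : ℕ} (hk : 1 ≤ k) {n : ℤ} (hn : Even n) (τ : ℍ) (z : ℂ)
    (hz : charDenom τ z ≠ 0) :
    thetaSym k n τ z = ∑ l ∈ (Finset.range (k + 1)).filter (fun l : ℕ => Even l),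
      transCoeff k n l τ * chi k l τ z := by
  rw [thetaSym_eq_sum_transCoeff_mul_chi hk n τ z hz]
  refine Finset.sum_congr (Finset.filter_congr fun l _ => ?_) fun _ _ => rfl
  rw [Int.even_iff] at hn
  rw [Nat.even_iff, Int.ModEq]
  omega

theorem psi6_eq_sum (τ : ℍ) (z : ℂ) (hz : charDenom τ z ≠ 0) :
    psi6 τ z = ∑ l ∈ (Finset.range 25).filter (fun l : ℕ => Even l),
      explicitCoeff l τ * chi 24 l τ z := by
  have hη := eta_ne_zero τ
  have h := eta_mul_psi6 τ z
  rw [thetaSym_eq_sum_even (by norm_num) (by decide) τ z hz,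
    thetaSym_eq_sum_even (by norm_num) (by decide) τ z hz,
    thetaSym_eq_sum_even (by norm_num) (by decide) τ z hz,
    thetaSym_eq_sum_even (by norm_num) (by decide) τ z hz, ← Finset.sum_add_distrib,
    ← Finset.sum_sub_distrib, ← Finset.sum_sub_distrib] at h
  rw [← mul_right_inj' hη, h, Finset.mul_sum]
  refine Finset.sum_congr rfl fun l hl => ?_
  rw [← sum_transCoeff_eq (Finset.mem_filter.mp hl).2]
  field_simp

/-- A sum over the even labels `l ≤ 24` whose coefficients are symmetric under `l ↦ 24 - l`,
grouped into the pairs that occur in `IsCharDecomposition`. -/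
lemma sum_even_eq (c : ℕ → ℂ) (hc : ∀ l ≤ 24, Even l → c (24 - l) = c l) (x : ℕ → ℂ) :
    ∑ l ∈ (Finset.range 25).filter (fun l : ℕ => Even l), c l * x l =
      c 12 * x 12 + c 10 * (x 10 + x 14) + c 8 * (x 8 + x 16) + c 6 * (x 6 + x 18) +
        c 4 * (x 4 + x 20) + c 2 * (x 2 + x 22) + c 0 * (x 0 + x 24) := by
  have hf : (Finset.range 25).filter (fun l : ℕ => Even l) =
      {0, 2, 4, 6, 8, 10, 12, 14, 16, 18, 20, 22, 24} := by decide
  have h10 : c 14 = c 10 := hc 10 (by norm_num) (by decide)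
  have h8 : c 16 = c 8 := hc 8 (by norm_num) (by decide)
  have h6 : c 18 = c 6 := hc 6 (by norm_num) (by decide)
  have h4 : c 20 = c 4 := hc 4 (by norm_num) (by decide)
  have h2 : c 22 = c 2 := hc 2 (by norm_num) (by decide)
  have h0 : c 24 = c 0 := hc 0 (by norm_num) (by decide)
  rw [hf]
  simp only [Finset.mem_insert, Finset.mem_singleton, Finset.sum_insert, Finset.sum_singleton,
    OfNat.zero_ne_ofNat, Nat.reduceEqDiff, or_self, not_false_eq_true]
  rw [h10, h8, h6, h4, h2, h0]
  ring

/-- The coefficient of `χ_{24,l}`, for even `l ≤ 24`, in the decomposition given by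
`g₁, …, g₇`. Counted from `0`, its index is `|12 - l| / 2`. -/
def labelCoeff (g : Fin 7 → ℍ → ℂ) (τ : ℍ) (l : ℕ) : ℂ :=
  g (Fin.ofNat 7 (((12 : ℤ) - l).natAbs / 2)) τ

lemma labelCoeff_reflect (g : Fin 7 → ℍ → ℂ) (τ : ℍ) {l : ℕ} (hl : l ≤ 24) :
    labelCoeff g τ (24 - l) = labelCoeff g τ l := by
  rw [labelCoeff, labelCoeff, show ((12 : ℤ) - (24 - l : ℕ)).natAbs = ((12 : ℤ) - l).natAbs by
    omega]

lemma isCharDecomposition_iff_sum (g : Fin 7 → ℍ → ℂ) :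
    IsCharDecomposition g ↔ ∀ (τ : ℍ) (z : ℂ), charDenom τ z ≠ 0 →
      psi6 τ z = ∑ l ∈ (Finset.range 25).filter (fun l : ℕ => Even l),
        labelCoeff g τ l * chi 24 l τ z := by
  refine forall_congr' fun τ => forall_congr' fun z => imp_congr_right fun _ => ?_
  rw [sum_even_eq (labelCoeff g τ) (fun l hl _ => labelCoeff_reflect g τ hl)
    (fun l => chi 24 l τ z)]
  rfl

lemma labelCoeff_of_fin (g : Fin 7 → ℍ → ℂ) (τ : ℍ) (j : Fin 7) :
    labelCoeff g τ (12 - 2 * (j : ℕ)) = g j τ := by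
  fin_cases j <;> rfl

theorem isCharDecomposition_iff (g : Fin 7 → ℍ → ℂ) :
    IsCharDecomposition g ↔ ∀ (j : Fin 7) (τ : ℍ), g j τ = explicitCoeff (12 - 2 * (j : ℕ)) τ := by
  rw [isCharDecomposition_iff_sum]
  constructor
  · intro h j τ
    have hzero := chi_linearIndependent 24
      (fun l => if Even l then labelCoeff g τ l - explicitCoeff l τ else 0) τ (fun z hz => by
        have h1 := h τ z hz
        rw [psi6_eq_sum τ z hz, eq_comm, ← sub_eq_zero, ← Finset.sum_sub_distrib,
          Finset.sum_filter] at h1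
        refine (Finset.sum_congr rfl fun l _ => ?_).trans h1
        split_ifs <;> ring) (j := 12 - 2 * (j : ℕ)) (by omega)
    have heven : Even (12 - 2 * (j : ℕ)) := ⟨6 - j, by omega⟩
    simp only [if_pos heven, labelCoeff_of_fin] at hzero
    exact sub_eq_zero.mp hzero
  · intro h τ z hz
    rw [psi6_eq_sum τ z hz]
    refine Finset.sum_congr rfl fun l hl => ?_
    obtain ⟨hl1, hl2⟩ := Finset.mem_filter.mp hl
    have hl24 : l ≤ 24 := by
      rw [Finset.mem_range] at hl1
      omega
    -- By the reflection symmetry of both sides it is enough to treat `l ≤ 12`.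
    have hlow : ∀ l' ≤ 12, Even l' → explicitCoeff l' τ = labelCoeff g τ l' := by
      rintro l' hl' ⟨i, rfl⟩
      have h1 := h ⟨6 - i, by omega⟩ τ
      rw [← labelCoeff_of_fin g] at h1
      simpa only [show 12 - 2 * (6 - i) = i + i by omega] using h1.symm
    congr 1
    by_cases h12 : l ≤ 12
    · exact hlow l h12 hl2
    · rw [← explicitCoeff_reflect hl24 hl2, ← labelCoeff_reflect g τ hl24]
      exact hlow _ (by omega) (by
        rw [Nat.even_iff] at hl2 ⊢
        omega)

end Umbral

end

theorem mainTheorem2 :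
    -- theta expansion of the umbral Jacobi form
    (∀ (τ : ℍ) (z : ℂ),
      Umbral.eta τ * Umbral.psi6 τ z =
        Umbral.thetaSym 24 2 τ z + Umbral.thetaSym 24 22 τ z
          - Umbral.thetaSym 24 10 τ z - Umbral.thetaSym 24 14 τ z) ∧
    -- the theta functions in terms of characters; all the series converge absolutely
    (∀ (k : ℕ), 1 ≤ k →
      (∀ (l : ℕ) (τ : ℍ), Summable (fun m : ℤ => Umbral.heckeTerm k l τ m)) ∧
      ∀ (n : ℤ) (τ : ℍ) (z : ℂ), Umbral.charDenom τ z ≠ 0 →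
        Umbral.thetaSym k n τ z =
          ∑ l ∈ (Finset.range (k + 1)).filter (fun l : ℕ => (l : ℤ) ≡ n [ZMOD 2]),
            Umbral.transCoeff k n l τ * Umbral.chi k l τ z) ∧
    -- the coefficients that result for the umbral Jacobi form
    (∀ (l : ℕ) (τ : ℍ), Even l →
      (Umbral.transCoeff 24 2 l τ + Umbral.transCoeff 24 22 l τ
          - Umbral.transCoeff 24 10 l τ - Umbral.transCoeff 24 14 l τ) / Umbral.eta τ =
        Umbral.explicitCoeff l τ) ∧
    (∀ (τ : ℍ) (z : ℂ), Umbral.charDenom τ z ≠ 0 →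
      Umbral.psi6 τ z =
        ∑ l ∈ (Finset.range 25).filter (fun l : ℕ => Even l),
          Umbral.explicitCoeff l τ * Umbral.chi 24 l τ z) ∧
    -- the closed form of `g₁, …, g₇`, with `g_j` the coefficient of `χ_{24,14-2j}`
    (∀ g : Fin 7 → ℍ → ℂ,
      Umbral.IsCharDecomposition g ↔
        ∀ (j : Fin 7) (τ : ℍ), g j τ = Umbral.explicitCoeff (12 - 2 * (j : ℕ)) τ) := by
  exact ⟨Umbral.eta_mul_psi6,
    fun _ hk => ⟨fun l τ => (Umbral.summable_heckeTerm hk l τ).of_norm,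
      fun n τ z hz => Umbral.thetaSym_eq_sum_transCoeff_mul_chi hk n τ z hz⟩,
    fun _ τ hl => Umbral.sum_transCoeff_eq hl τ, Umbral.psi6_eq_sum, Umbral.isCharDecomposition_iff⟩
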